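/- All channels below are discrete memoryless channels, given by transition probabilities $W(y|x)$ with a finite input alphabet $\mathcal X$, $q=|\mathcal X|$, and a discrete output alphabet. For such a channel, $I(W)$ denotes the mutual information in bits between a uniformly distributed input and the output, $Z_{x,x'}(W)=\sum_y\sqrt{W(y|x)W(y|x')}$, and $Z(W)=\frac1{q(q-1)}\sum_{x\ne x'}Z_{x,x'}(W)$. **Kernels.** Consider a decomposition of $\{0,1\}^4$ described by the chain $(4,4,1)-(4,3,2)-(4,1,4)$: $\{0,1\}^4$ is partitioned into two codes $T_2^{(u_1)}$, $u_1\in\{0,1\}$, of size $2^3$ and minimum distance at least $2$; each $T_2^{(u_1)}$ is partitioned into four codes $T_3^{(u_1,u_{2,3})}$, $u_{2,3}\in\{0,1\}^2$, of size $2$ and minimum distance at least $4$; each $T_3^{(u_1,u_{2,3})}$ is partitioned into two one-word codes indexed by $u_4\in\{0,1\}$. Let $g_1:\{0,1\}\times\{0,1\}^2\times\{0,1\}\to\{0,1\}^4$ be the induced map, i.e. $g_1(u_1,u_{2,3},u_4)$ is the word selected by $(u_1,u_{2,3},u_4)$. Let $g_2$ be a bijection of $(\{0,1\}^2)^4$ onto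 itself. For a binary-input channel $W$, let $W^{(1)},W^{(2,3)},W^{(4)}$ be the channels with inputs $u_1$, $u_{2,3}$, $u_4$ obtained by sending $g_1(u_1,u_{2,3},u_4)$ over four independent copies of $W$, where the output consists of the four channel outputs and the previous inputs, and where the other inputs are uniform (the later ones being averaged out). For a quaternary-input channel $W$, let $W^{(i)}$, $i=1,\dots,4$, be the four channels obtained in the same way from $g_2$; the input of $W^{(i)}$ is the $i$-th quaternary symbol. The kernel $g_2$ is *polarizing* if for every quaternary-input channel $\tilde W$, with $\tilde W_0=\tilde W$ and $\tilde W_{n+1}=\tilde W_n^{(i_n)}$ for independent uniform $i_n\in\{1,2,3,4\}$, one has $\lim_{n\to\infty}\Pr(I(\tilde W_n)/2\in(\delta,1-\delta))=0$ for all $\delta\in(0,1/2)$. **Tree process.** Let $(B^{(1)}_n)_{n\ge0}$ be i.i.d. with values $1,(2,3),4$ of probabilities $\frac14,\frac12,\frac14$, and let $(B^{(2)}_n)_{n\ge0}$ be i.i.d. uniform on the four indices of $g_2$, the two sequences being independent. Let $T=\min\{n\ge0: B^{(1)}_n=(2,3)\}$, $N_n=1$ for $n\le T$, $N_n=2$ for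 $n>T$, and $B_n=B_n^{(N_n)}$. For a binary-input channel $W$ let $W_0=W$, $W_{n+1}=W_n^{(B_n)}$ and $Z_n=Z(W_n)$. **Exponents.** Let $d_H$ be the Hamming distance over the alphabet $\{0,1\}^2$. For $x,x'\in\{0,1\}^2$ let $$D^{(i)}_{2,x,x'}=\min_{v_1^{i-1}}\ \min_{w_{i+1}^4,\tilde w_{i+1}^4} d_H\big(g_2(v_1^{i-1},x,w_{i+1}^4),\,g_2(v_1^{i-1},x',\tilde w_{i+1}^4)\big),$$ $D^{(i)}_{2,\min}=\min_{x\ne x'}D^{(i)}_{2,x,x'}$, $D^{(i)}_{2,\max}=\max_{x,x'}D^{(i)}_{2,x,x'}$, and $$E_1(g_2)=\tfrac14\sum_{i=1}^4\log_4 D^{(i)}_{2,\min},\qquad E_2(g_2)=\tfrac14\sum_{i=1}^4\log_4 D^{(i)}_{2,\max}.$$ **Proposition.** If $g_2$ is polarizing and $W$ is a binary-input channel with $Z(W)\ne0$, then $$\lim_{n\to\infty}\Pr\big(Z_n\le 2^{-4^{\beta n}}\big)=I(W)\qquad\text{for all } 0\le\beta<E_1(g_2),$$ $$\lim_{n\to\infty}\Pr\big(Z_n\ge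 2^{-4^{\beta n}}\big)=1\qquad\text{for all } \beta>E_2(g_2).$$ -/

import Mathlib

open Filter Topology MeasureTheory ProbabilityTheory

noncomputable section

namespace MixedKernel

/-- The binary alphabet `{0,1}`. -/
abbrev Bit : Type := Fin 2

/-- The quaternary alphabet `{0,1}²` (two glued bits). -/
abbrev Pair : Type := Fin 2 × Fin 2

/-- Binary words of length 4. -/
abbrev Word : Type := Fin 4 → Bit

/-! ### Discrete memoryless channels -/

/-- A discrete channel with input alphabet `X`; `prob x y` is the transition probability `W(y|x)`.
The output alphabet may be infinite (each law is then carried by countably many letters). -/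
structure Channel (X : Type) where
  /-- the output alphabet -/
  Out : Type
  /-- the transition probabilities -/
  prob : X → Out → ℝ
  prob_nonneg : ∀ x y, 0 ≤ prob x y
  hasSum_prob : ∀ x, HasSum (prob x) 1

theorem hasSum_pi_prod {Y : Type} (n : ℕ) (p : Fin n → Y → ℝ) (h0 : ∀ j y, 0 ≤ p j y)
    (h1 : ∀ j, HasSum (p j) 1) : HasSum (fun y : Fin n → Y => ∏ j, p j (y j)) 1 := by
  induction n with
  | zero =>
    simp
  | succ n ih =>
    have hs := ih (fun j => p j.succ) (fun j => h0 j.succ) (fun j => h1 j.succ)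
    have hF0 : ∀ y : Fin n → Y, 0 ≤ ∏ j, p (Fin.succ j) (y j) :=
      fun y => Finset.prod_nonneg fun j _ => h0 _ _
    generalize hF : (fun y : Fin n → Y => ∏ j, p (Fin.succ j) (y j)) = F at hs
    have hF0' : 0 ≤ F := by
      rw [← hF]
      exact hF0
    have hsum : Summable (fun z : Y × (Fin n → Y) => p 0 z.1 * F z.2) :=
      Summable.mul_of_nonneg (h1 0).summable hs.summable (h0 0) hF0'
    have hm := (h1 0).mul hs hsum
    rw [one_mul] at hm
    rw [← (Fin.consEquiv (fun _ : Fin (n + 1) => Y)).hasSum_iff]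
    have he : (fun y : Fin (n + 1) → Y => ∏ j, p j (y j)) ∘
        (Fin.consEquiv (fun _ : Fin (n + 1) => Y)) = fun z => p 0 z.1 * F z.2 := by
      funext z
      rw [Function.comp_apply, Fin.prod_univ_succ, ← hF]
      rfl
    rw [he]
    exact hm

namespace Channel

variable {X : Type}

/-- Symmetric capacity: the mutual information (in bits) between a uniform input
and the output of the channel. -/
def info [Fintype X] (W : Channel X) : ℝ :=
  ∑' y, ∑ x, (1 / (Fintype.card X : ℝ)) * W.prob x y *
    Real.logb 2 (W.prob x y / ∑ x', (1 / (Fintype.card X : ℝ)) * W.prob x' y)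

/-- Bhattacharyya parameter between two input letters. -/
def bhatt (W : Channel X) (x x' : X) : ℝ :=
  ∑' y, Real.sqrt (W.prob x y * W.prob x' y)

/-- (Average) Bhattacharyya parameter `Z(W)` of a `q`-ary channel. -/
def Z [Fintype X] [DecidableEq X] (W : Channel X) : ℝ :=
  (1 / ((Fintype.card X : ℝ) * ((Fintype.card X : ℝ) - 1))) *
    ∑ x, ∑ x', if x ≠ x' then W.bhatt x x' else 0

/-- Channel splitting.  The word `f a b c` of length 4 is sent over four independent copies of `W`.
The split channel has input `b`; the previous inputs `a` are part of its output, and the later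
inputs `c` are averaged out; all inputs are uniform. -/
def split (W : Channel X) {A B C : Type} [Fintype A] [Nonempty A] [Fintype C] [Nonempty C]
    (f : A → B → C → Fin 4 → X) : Channel B where
  Out := (Fin 4 → W.Out) × A
  prob b o := ∑ c, (1 / ((Fintype.card A : ℝ) * (Fintype.card C : ℝ))) *
    ∏ j, W.prob (f o.2 b c j) (o.1 j)
  prob_nonneg b o := Finset.sum_nonneg fun c _ =>
    mul_nonneg (by positivity) (Finset.prod_nonneg fun j _ => W.prob_nonneg _ _)
  hasSum_prob b := by
    have h : ∀ a : A, HasSum (fun y : Fin 4 → W.Out => ∑ c,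
        (1 / ((Fintype.card A : ℝ) * (Fintype.card C : ℝ))) * ∏ j, W.prob (f a b c j) (y j))
        (1 / (Fintype.card A : ℝ)) := by
      intro a
      have := hasSum_sum (s := (Finset.univ : Finset C)) fun c _ =>
        (hasSum_pi_prod 4 (fun j => W.prob (f a b c j)) (fun j y => W.prob_nonneg _ _)
          (fun j => W.hasSum_prob _)).mul_left
          (1 / ((Fintype.card A : ℝ) * (Fintype.card C : ℝ)))
      have he : ∑ _c : C, 1 / ((Fintype.card A : ℝ) * (Fintype.card C : ℝ)) * 1
          = 1 / (Fintype.card A : ℝ) := by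
        rw [Finset.sum_const, Finset.card_univ, nsmul_eq_mul]
        field_simp
      rwa [he] at this
    have hs : Summable (fun o : (Fin 4 → W.Out) × A => ∑ c,
        (1 / ((Fintype.card A : ℝ) * (Fintype.card C : ℝ))) *
          ∏ j, W.prob (f o.2 b c j) (o.1 j)) := by
      rw [← (Equiv.prodComm A (Fin 4 → W.Out)).summable_iff]
      rw [summable_prod_of_nonneg]
      · exact ⟨fun a => (h a).summable, (hasSum_fintype _).summable⟩
      · exact fun o => Finset.sum_nonneg fun c _ =>
          mul_nonneg (by positivity) (Finset.prod_nonneg fun j _ => W.prob_nonneg _ _)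
    have ht := hs.hasSum
    rw [← (Equiv.prodComm A (Fin 4 → W.Out)).hasSum_iff] at ht
    have := ht.prod_fiberwise h
    have h2 := (hasSum_fintype (fun _ : A => 1 / (Fintype.card A : ℝ))).unique this
    rw [← h2] at ht
    rw [← (Equiv.prodComm A (Fin 4 → W.Out)).hasSum_iff]
    simpa using ht

end Channel

/-! ### The binary kernel `g₁` with glued second and third input bits -/

/-- The sets `F b` form a partition of `S`. -/
def IsPartition {B : Type} [Fintype B] (F : B → Finset Word) (S : Finset Word) : Prop :=
  Pairwise (fun b b' => Disjoint (F b) (F b')) ∧ Finset.univ.biUnion F = S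

/-- The code `S` has minimum distance at least `d`. -/
def MinDistGE (S : Finset Word) (d : ℕ) : Prop :=
  ∀ x ∈ S, ∀ y ∈ S, x ≠ y → d ≤ hammingDist x y

/-- A decomposition of `{0,1}⁴` described by the chain `(4,4,1)-(4,3,2)-(4,1,4)` (and ending in
one-word codes): `{0,1}⁴` is partitioned into the two codes `T₂ u₁` of size `2³` and distance
at least 2, each of these into the four codes `T₃ u₁ u₂₃` of size `2¹` and distance at least 4,
and each of these into the two one-word codes `T₄ u₁ u₂₃ u₄`. -/
structure CodeDecomposition where
  T₂ : Bit → Finset Word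
  T₃ : Bit → Pair → Finset Word
  T₄ : Bit → Pair → Bit → Finset Word
  partition₂ : IsPartition T₂ Finset.univ
  partition₃ : ∀ a, IsPartition (T₃ a) (T₂ a)
  partition₄ : ∀ a p, IsPartition (T₄ a p) (T₃ a p)
  card₂ : ∀ a, (T₂ a).card = 2 ^ 3
  card₃ : ∀ a p, (T₃ a p).card = 2 ^ 1
  card₄ : ∀ a p b, (T₄ a p b).card = 1
  dist₂ : ∀ a, MinDistGE (T₂ a) 2
  dist₃ : ∀ a p, MinDistGE (T₃ a p) 4

/-- `g` is the transformation induced by the decomposition `T`. -/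
def CodeDecomposition.Induces (T : CodeDecomposition) (g : Bit → Pair → Bit → Word) : Prop :=
  ∀ a p b, g a p b ∈ T.T₄ a p b

/-- `W^{(1)}`: input `u₁`. -/
def binFirst (g : Bit → Pair → Bit → Word) (W : Channel Bit) : Channel Bit :=
  W.split fun (_ : Unit) (u₁ : Bit) (c : Pair × Bit) => g u₁ c.1 c.2

/-- `W^{(2,3)}`: input the glued pair `u₂₃`. -/
def binGlued (g : Bit → Pair → Bit → Word) (W : Channel Bit) : Channel Pair :=
  W.split fun (u₁ : Bit) (u₂₃ : Pair) (u₄ : Bit) => g u₁ u₂₃ u₄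

/-- `W^{(4)}`: input `u₄`. -/
def binLast (g : Bit → Pair → Bit → Word) (W : Channel Bit) : Channel Bit :=
  W.split fun (a : Bit × Pair) (u₄ : Bit) (_ : Unit) => g a.1 a.2 u₄

/-! ### Quaternary kernels -/

/-- A quaternary kernel of dimension 4: a bijection of `({0,1}²)⁴`. -/
abbrev QuatKernel : Type := (Fin 4 → Pair) ≃ (Fin 4 → Pair)

/-- The vector with entries `a` before position `i`, entry `x` at `i`, and entries `c` after `i`. -/
def assemble (i : Fin 4) (a : {j : Fin 4 // j < i} → Pair) (x : Pair)
    (c : {j : Fin 4 // i < j} → Pair) : Fin 4 → Pair := fun j =>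
  if h : j < i then a ⟨j, h⟩ else if h' : i < j then c ⟨j, h'⟩ else x

/-- The `i`-th split channel of the quaternary channel `W` under the kernel `g`. -/
def quatSplit (g : QuatKernel) (W : Channel Pair) (i : Fin 4) : Channel Pair :=
  W.split fun a x c => g (assemble i a x c)

/-- The channel reached from `W` along the path `b` (its first `n` entries), using only `g`. -/
def quatChannel (g : QuatKernel) (W : Channel Pair) (b : ℕ → Fin 4) : ℕ → Channel Pair
  | 0 => W
  | n + 1 => quatSplit g (quatChannel g W b n) (b n)

/-- `g` is polarizing: for every quaternary channel, the construction based on `g` only satisfies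
`Pr(I(W_n)/2 ∈ (δ, 1-δ)) → 0`, where the path of length `n` is uniformly distributed
on `(Fin 4)ⁿ`. -/
def IsPolarizing (g : QuatKernel) : Prop :=
  ∀ W : Channel Pair, ∀ δ : ℝ, 0 < δ → δ < 1 / 2 →
    Tendsto (fun n : ℕ =>
      (Nat.card {b : Fin n → Fin 4 //
        (quatChannel g W (fun k => if h : k < n then b ⟨k, h⟩ else 0) n).info / 2
          ∈ Set.Ioo δ (1 - δ)} : ℝ) / 4 ^ n) atTop (𝓝 0)

/-- The partial distance `D^{(i)}_{x,x'}(v)` given the previous inputs `v`. -/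
def partialDistAt (g : QuatKernel) (i : Fin 4) (x x' : Pair)
    (v : {j : Fin 4 // j < i} → Pair) : ℕ :=
  ⨅ w : ({j : Fin 4 // i < j} → Pair) × ({j : Fin 4 // i < j} → Pair),
    hammingDist (g (assemble i v x w.1)) (g (assemble i v x' w.2))

/-- The partial distance `D^{(i)}_{x,x'}`. -/
def partialDist (g : QuatKernel) (i : Fin 4) (x x' : Pair) : ℕ :=
  ⨅ v : {j : Fin 4 // j < i} → Pair, partialDistAt g i x x' v

/-- `D^{(i)}_min`, the minimum over distinct letters. -/
def partialDistMin (g : QuatKernel) (i : Fin 4) : ℕ :=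
  ⨅ p : {p : Pair × Pair // p.1 ≠ p.2}, partialDist g i p.1.1 p.1.2

/-- `D^{(i)}_max`. -/
def partialDistMax (g : QuatKernel) (i : Fin 4) : ℕ :=
  ⨆ p : Pair × Pair, partialDist g i p.1 p.2

/-- The lower bound `E₁(g)` on the exponent. -/
def E₁ (g : QuatKernel) : ℝ := (1 / 4) * ∑ i, Real.logb 4 (partialDistMin g i)

/-- The upper bound `E₂(g)` on the exponent. -/
def E₂ (g : QuatKernel) : ℝ := (1 / 4) * ∑ i, Real.logb 4 (partialDistMax g i)

/-! ### The channel tree process of the mixed kernel -/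

/-- A channel of the mixed construction: its input is a single bit or a glued pair. -/
abbrev MixedChannel : Type 1 := Channel Bit ⊕ Channel Pair

/-- The Bhattacharyya parameter of a channel of the mixed construction. -/
def MixedChannel.Z : MixedChannel → ℝ
  | Sum.inl W => Channel.Z W
  | Sum.inr W => Channel.Z W

/-- One step of the tree process.  A channel with a one-bit input (`N = 1`) is split by `g₁`
according to `b₁`, where `0, 1, 2` stand for the indices `1, (2,3), 4`; a channel with a two-bit
input (`N = 2`) is split by `g₂` according to `b₂`. -/
def mixedStep (g₁ : Bit → Pair → Bit → Word) (g₂ : QuatKernel) (b₁ : Fin 3) (b₂ : Fin 4) :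
    MixedChannel → MixedChannel
  | Sum.inl W =>
      if b₁ = 0 then Sum.inl (binFirst g₁ W)
      else if b₁ = 1 then Sum.inr (binGlued g₁ W)
      else Sum.inl (binLast g₁ W)
  | Sum.inr W => Sum.inr (quatSplit g₂ W b₂)

/-- The channels `W_n` along the sample path `(b₁, b₂)`.  With `T` the least `n` such that
`b₁ n = 1`, the channel `W_n` has a one-bit input for `n ≤ T` and a two-bit input for `n > T`. -/
def mixedChannel (g₁ : Bit → Pair → Bit → Word) (g₂ : QuatKernel) (W : Channel Bit)
    (b₁ : ℕ → Fin 3) (b₂ : ℕ → Fin 4) : ℕ → MixedChannel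
  | 0 => Sum.inl W
  | n + 1 => mixedStep g₁ g₂ (b₁ n) (b₂ n) (mixedChannel g₁ g₂ W b₁ b₂ n)

/-- The random choices driving the tree process: `B₁ n` are i.i.d. with values `1, (2,3), 4`
(written `0, 1, 2`) of probabilities `1/4, 1/2, 1/4`, `B₂ n` are i.i.d. uniform on the four
indices of `g₂`, and the two sequences are independent. -/
structure IsDriving {Ω : Type*} [MeasurableSpace Ω] (P : Measure Ω)
    (B₁ : ℕ → Ω → Fin 3) (B₂ : ℕ → Ω → Fin 4) : Prop where
  measurable₁ : ∀ n, Measurable (B₁ n)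
  measurable₂ : ∀ n, Measurable (B₂ n)
  indep₁ : iIndepFun B₁ P
  indep₂ : iIndepFun B₂ P
  indep : IndepFun (fun ω n => B₁ n ω) (fun ω n => B₂ n ω) P
  law₁_zero : ∀ n, P.real {ω | B₁ n ω = 0} = 1 / 4
  law₁_one : ∀ n, P.real {ω | B₁ n ω = 1} = 1 / 2
  law₁_two : ∀ n, P.real {ω | B₁ n ω = 2} = 1 / 4
  law₂ : ∀ n i, P.real {ω | B₂ n ω = i} = 1 / 4

/-- The random variable `Z_n = Z(W_n)`. -/
def Zproc {Ω : Type*} (g₁ : Bit → Pair → Bit → Word) (g₂ : QuatKernel) (W : Channel Bit)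
    (B₁ : ℕ → Ω → Fin 3) (B₂ : ℕ → Ω → Fin 4) (n : ℕ) (ω : Ω) : ℝ :=
  (mixedChannel g₁ g₂ W (fun k => B₁ k ω) (fun k => B₂ k ω) n).Z

end MixedKernel

end

noncomputable section

namespace MixedKernel

/-! ### Sums over product alphabets -/

/-! Divide mutual information by the number of input bits. Since `g₁` and `g₂` are bijections, the
entropy chain rule preserves total information under splitting, and the probabilities 1/4, 1/2, 1/4
are exactly input bits over four. So the normalized information is a martingale in [0,1]
(`sum_normInfo_mixedStep`, `setIntegral_infoProc_succ`): it converges almost surely and has mean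
`W.info` at all times. Almost surely the glued index occurs at some time; from then on the process
is driven by `g₂` alone, started from one of countably many channels, and polarization forces the
limit to be 0 or 1.

Entropy and Bhattacharyya inequalities translate the limit: at 0, Z stays above 1/2; at 1, Z tends
to 0. In the second case Z is, up to constants, at most raised to the power `partialDistMin` at each
step, and the strong law for the logarithms of these distances gives double exponential decay with
any exponent below `E₁` (`eventually_le_of_le_mul_pow`). Hence the indicator of the event Z_n ≤
2^(-4^(βn)) minus the normalized information tends to 0 almost surely, and dominated convergence
gives the first limit.

The second limit needs no polarization. All pairwise parameters start positive because Z(W) ≠ 0, and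
a quaternary step sends a lower bound z for them to at least z^`partialDistMax` / 64. The strong law
again bounds the growth of -log z, now by any exponent above `E₂`. -/

theorem hasSum_pi_prod_of_nonneg {Y : Type} (n : ℕ) (p : Fin n → Y → ℝ) (s : Fin n → ℝ)
    (h0 : ∀ j y, 0 ≤ p j y) (h1 : ∀ j, HasSum (p j) (s j)) :
    HasSum (fun y : Fin n → Y => ∏ j, p j (y j)) (∏ j, s j) := by
  induction n with
  | zero => simp
  | succ n ih =>
    have hs := ih (fun j => p j.succ) (fun j => s j.succ) (fun j => h0 j.succ)
      (fun j => h1 j.succ)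
    have hF0 : ∀ y : Fin n → Y, 0 ≤ ∏ j, p (Fin.succ j) (y j) :=
      fun y => Finset.prod_nonneg fun j _ => h0 _ _
    generalize hF : (fun y : Fin n → Y => ∏ j, p (Fin.succ j) (y j)) = F at hs
    have hF0' : 0 ≤ F := by
      rw [← hF]
      exact hF0
    have hsum : Summable (fun z : Y × (Fin n → Y) => p 0 z.1 * F z.2) :=
      Summable.mul_of_nonneg (h1 0).summable hs.summable (h0 0) hF0'
    have hm := (h1 0).mul hs hsum
    rw [← (Fin.consEquiv (fun _ : Fin (n + 1) => Y)).hasSum_iff, Fin.prod_univ_succ]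
    have he : (fun y : Fin (n + 1) → Y => ∏ j, p j (y j)) ∘
        (Fin.consEquiv (fun _ : Fin (n + 1) => Y)) = fun z => p 0 z.1 * F z.2 := by
      funext z
      rw [Function.comp_apply, Fin.prod_univ_succ, ← hF]
      rfl
    rw [he]
    exact hm

/-- `F` is a finite sum of functions, each supported on one slice; hence no sign condition is
needed. -/
theorem hasSum_prod_fintype {Y A : Type} [Fintype A] {F : Y × A → ℝ} {s : A → ℝ}
    (h : ∀ a, HasSum (fun y => F (y, a)) (s a)) : HasSum F (∑ a, s a) := by
  classical
  have key : ∀ a, HasSum (fun z : Y × A => if z.2 = a then F z else 0) (s a) := by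
    intro a
    have hinj : Function.Injective (fun y : Y => (y, a)) := fun y y' hy => (Prod.mk.inj hy).1
    rw [← hinj.hasSum_iff]
    · simpa [Function.comp_def] using h a
    · intro z hz
      rw [if_neg]
      rintro rfl
      exact hz ⟨z.1, rfl⟩
  convert hasSum_sum (s := (Finset.univ : Finset A)) fun a _ => key a using 1
  funext z
  simp

theorem sqrt_sum_le_sum_sqrt {ι : Type} (s : Finset ι) (f : ι → ℝ) (hf : ∀ i, 0 ≤ f i) :
    √(∑ i ∈ s, f i) ≤ ∑ i ∈ s, √(f i) := by
  rw [Real.sqrt_le_left (Finset.sum_nonneg fun i _ => Real.sqrt_nonneg _)]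
  calc ∑ i ∈ s, f i = ∑ i ∈ s, √(f i) ^ 2 :=
        Finset.sum_congr rfl fun i _ => (Real.sq_sqrt (hf i)).symm
    _ ≤ (∑ i ∈ s, √(f i)) ^ 2 :=
        Finset.sum_sq_le_sq_sum_of_nonneg fun i _ => Real.sqrt_nonneg _

/-! ### Bhattacharyya parameters of a channel and of its splits -/

namespace Channel

variable {X : Type}

theorem summable_sqrt (W : Channel X) (x x' : X) :
    Summable fun y => √(W.prob x y * W.prob x' y) := by
  refine Summable.of_nonneg_of_le (fun y => Real.sqrt_nonneg _) (fun y => ?_)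
    ((W.hasSum_prob x).summable.add (W.hasSum_prob x').summable)
  have h1 := W.prob_nonneg x y
  have h2 := W.prob_nonneg x' y
  exact (Real.sqrt_le_left (by positivity)).2 (by nlinarith)

theorem bhatt_nonneg (W : Channel X) (x x' : X) : 0 ≤ W.bhatt x x' :=
  tsum_nonneg fun _ => Real.sqrt_nonneg _

theorem bhatt_self (W : Channel X) (x : X) : W.bhatt x x = 1 := by
  have : ∀ y, √(W.prob x y * W.prob x y) = W.prob x y := fun y =>
    Real.sqrt_mul_self (W.prob_nonneg x y)
  simp_rw [bhatt, this]
  exact (W.hasSum_prob x).tsum_eq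

theorem bhatt_comm (W : Channel X) (x x' : X) : W.bhatt x x' = W.bhatt x' x := by
  simp_rw [bhatt, mul_comm]

theorem bhatt_le_one (W : Channel X) (x x' : X) : W.bhatt x x' ≤ 1 := by
  have h := ((W.hasSum_prob x).add (W.hasSum_prob x')).div_const 2
  norm_num at h
  refine ((W.summable_sqrt x x').tsum_le_tsum (fun y => ?_) h.summable).trans h.tsum_eq.le
  have h1 := W.prob_nonneg x y
  have h2 := W.prob_nonneg x' y
  exact (Real.sqrt_le_left (by positivity)).2 (by nlinarith [sq_nonneg (W.prob x y - W.prob x' y)])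

section Split

variable {A B C : Type} [Fintype A] [Nonempty A] [Fintype C] [Nonempty C]

/-- The Bhattacharyya sums of two words sent over four copies of `W`. -/
theorem hasSum_sqrt_word (W : Channel X) (u v : Fin 4 → X) :
    HasSum (fun y : Fin 4 → W.Out => √((∏ j, W.prob (u j) (y j)) * ∏ j, W.prob (v j) (y j)))
      (∏ j, W.bhatt (u j) (v j)) := by
  convert hasSum_pi_prod_of_nonneg 4 (fun j y => √(W.prob (u j) y * W.prob (v j) y))
    (fun j => W.bhatt (u j) (v j))
    (fun j y => Real.sqrt_nonneg _) (fun j => (W.summable_sqrt (u j) (v j)).hasSum) using 1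
  funext y
  rw [← Finset.prod_mul_distrib, Real.sqrt_prod]
  intro j _
  exact mul_nonneg (W.prob_nonneg _ _) (W.prob_nonneg _ _)

/-- Subadditivity of the square root pulls out both sums over later inputs; what remains factorizes
over the four copies. -/
theorem bhatt_split_le (W : Channel X) (f : A → B → C → Fin 4 → X) (b b' : B) :
    (W.split f).bhatt b b' ≤ ∑ a, ∑ c, ∑ c',
      (1 / ((Fintype.card A : ℝ) * (Fintype.card C : ℝ))) *
        ∏ j, W.bhatt (f a b c j) (f a b' c' j) := by
  set K : ℝ := 1 / ((Fintype.card A : ℝ) * (Fintype.card C : ℝ)) with hK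
  have hK0 : 0 ≤ K := by positivity
  have hs : HasSum (fun o : (Fin 4 → W.Out) × A => ∑ c, ∑ c',
      K * √((∏ j, W.prob (f o.2 b c j) (o.1 j)) * ∏ j, W.prob (f o.2 b' c' j) (o.1 j)))
      (∑ a, ∑ c, ∑ c', K * ∏ j, W.bhatt (f a b c j) (f a b' c' j)) :=
    hasSum_prod_fintype fun a => hasSum_sum fun c _ => hasSum_sum fun c' _ =>
      (W.hasSum_sqrt_word (f a b c) (f a b' c')).mul_left K
  refine (((W.split f).summable_sqrt b b').tsum_le_tsum (fun o => ?_) hs.summable).trans hs.tsum_eq.le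
  have hp : ∀ b c, 0 ≤ ∏ j, W.prob (f o.2 b c j) (o.1 j) := fun b c =>
    Finset.prod_nonneg fun j _ => W.prob_nonneg _ _
  change √((∑ c, K * ∏ j, W.prob (f o.2 b c j) (o.1 j)) *
    ∑ c', K * ∏ j, W.prob (f o.2 b' c' j) (o.1 j)) ≤ _
  rw [Finset.sum_mul_sum]
  refine (sqrt_sum_le_sum_sqrt _ _ fun c => Finset.sum_nonneg fun c' _ =>
    mul_nonneg (mul_nonneg hK0 (hp _ _)) (mul_nonneg hK0 (hp _ _))).trans ?_
  refine Finset.sum_le_sum fun c _ => (sqrt_sum_le_sum_sqrt _ _ fun c' =>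
    mul_nonneg (mul_nonneg hK0 (hp _ _)) (mul_nonneg hK0 (hp _ _))).trans ?_
  refine Finset.sum_le_sum fun c' _ => le_of_eq ?_
  rw [mul_mul_mul_comm, Real.sqrt_mul (mul_nonneg hK0 hK0), Real.sqrt_mul_self hK0]

/-- All terms are nonnegative, so one may keep a single previous input and a single pair of later
inputs. -/
theorem le_bhatt_split (W : Channel X) (f : A → B → C → Fin 4 → X) (b b' : B) (a : A) (c c' : C) :
    (1 / ((Fintype.card A : ℝ) * (Fintype.card C : ℝ))) *
        ∏ j, W.bhatt (f a b c j) (f a b' c' j) ≤ (W.split f).bhatt b b' := by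
  set K : ℝ := 1 / ((Fintype.card A : ℝ) * (Fintype.card C : ℝ)) with hK
  have hK0 : 0 ≤ K := by positivity
  have hs := (W.hasSum_sqrt_word (f a b c) (f a b' c')).mul_left K
  have hinj : Function.Injective (fun y : Fin 4 → W.Out => ((y, a) : (W.split f).Out)) :=
    fun y y' hy => (Prod.mk.inj hy).1
  rw [← hs.tsum_eq]
  refine Summable.tsum_le_tsum_of_inj _ hinj (fun o _ => Real.sqrt_nonneg _) (fun y => ?_)
    hs.summable ((W.split f).summable_sqrt b b')
  have hp : ∀ b c, 0 ≤ ∏ j, W.prob (f a b c j) (y j) := fun b c =>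
    Finset.prod_nonneg fun j _ => W.prob_nonneg _ _
  change _ ≤ √((∑ c, K * ∏ j, W.prob (f a b c j) (y j)) *
    ∑ c', K * ∏ j, W.prob (f a b' c' j) (y j))
  have he : K * √((∏ j, W.prob (f a b c j) (y j)) * ∏ j, W.prob (f a b' c' j) (y j)) =
      √((K * ∏ j, W.prob (f a b c j) (y j)) * (K * ∏ j, W.prob (f a b' c' j) (y j))) := by
    rw [mul_mul_mul_comm, Real.sqrt_mul (mul_nonneg hK0 hK0), Real.sqrt_mul_self hK0]
  rw [he]
  exact Real.sqrt_le_sqrt (mul_le_mul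
    (Finset.single_le_sum (f := fun c => K * ∏ j, W.prob (f a b c j) (y j))
      (fun c _ => mul_nonneg hK0 (hp _ _)) (Finset.mem_univ c))
    (Finset.single_le_sum (f := fun c => K * ∏ j, W.prob (f a b' c j) (y j))
      (fun c _ => mul_nonneg hK0 (hp _ _)) (Finset.mem_univ c'))
    (mul_nonneg hK0 (hp _ _)) (Finset.sum_nonneg fun c _ => mul_nonneg hK0 (hp _ _)))

theorem bhatt_split_pos (W : Channel X) (hW : ∀ x x', 0 < W.bhatt x x')
    (f : A → B → C → Fin 4 → X) (b b' : B) : 0 < (W.split f).bhatt b b' := by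
  refine lt_of_lt_of_le ?_ (W.le_bhatt_split f b b' (Classical.arbitrary A)
    (Classical.arbitrary C) (Classical.arbitrary C))
  exact mul_pos (by positivity) (Finset.prod_pos fun j _ => hW _ _)

end Split

theorem prod_bhatt_le [DecidableEq X] (W : Channel X) {z : ℝ}
    (hz : ∀ x x', x ≠ x' → W.bhatt x x' ≤ z) (u v : Fin 4 → X) :
    ∏ j, W.bhatt (u j) (v j) ≤ z ^ hammingDist u v := by
  calc ∏ j, W.bhatt (u j) (v j) ≤ ∏ j, if u j ≠ v j then z else 1 := by
        refine Finset.prod_le_prod (fun j _ => W.bhatt_nonneg _ _) fun j _ => ?_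
        split_ifs with h
        · exact hz _ _ h
        · exact W.bhatt_le_one _ _
    _ = z ^ hammingDist u v := by
        rw [← Finset.prod_filter, Finset.prod_const]
        rfl

theorem pow_hammingDist_le_prod_bhatt [DecidableEq X] (W : Channel X) {z : ℝ} (hz0 : 0 ≤ z)
    (hz : ∀ x x', x ≠ x' → z ≤ W.bhatt x x') (u v : Fin 4 → X) :
    z ^ hammingDist u v ≤ ∏ j, W.bhatt (u j) (v j) := by
  calc z ^ hammingDist u v = ∏ j, if u j ≠ v j then z else 1 := by
        rw [← Finset.prod_filter, Finset.prod_const]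
        rfl
    _ ≤ ∏ j, W.bhatt (u j) (v j) := by
        refine Finset.prod_le_prod (fun j _ => by split_ifs <;> simp [hz0]) fun j _ => ?_
        split_ifs with h
        · exact hz _ _ h
        · rw [not_not.1 h, W.bhatt_self]

theorem card_offDiag_univ (X : Type) [Fintype X] [DecidableEq X] :
    ((Finset.univ : Finset X).offDiag.card : ℝ)
      = (Fintype.card X : ℝ) * ((Fintype.card X : ℝ) - 1) := by
  rw [Finset.offDiag_card, Finset.card_univ, Nat.cast_sub (Nat.le_mul_self _)]
  push_cast
  ring

section Average

variable [Fintype X] [DecidableEq X]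

/-- With `card_offDiag_univ`, this shows Z as a genuine average over ordered pairs of distinct
letters, so pairwise bounds pass to it. -/
theorem Z_eq_offDiag (W : Channel X) :
    W.Z = (1 / ((Fintype.card X : ℝ) * ((Fintype.card X : ℝ) - 1))) *
      ∑ p ∈ (Finset.univ : Finset X).offDiag, W.bhatt p.1 p.2 := by
  have : (Finset.univ : Finset X).offDiag
      = (Finset.univ ×ˢ Finset.univ).filter (fun p : X × X => p.1 ≠ p.2) := by
    ext p; simp
  rw [Z, this, Finset.sum_filter, Finset.sum_product]

theorem Z_nonneg (W : Channel X) : 0 ≤ W.Z := by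
  rw [Z_eq_offDiag, ← card_offDiag_univ X]
  exact mul_nonneg (by positivity) (Finset.sum_nonneg fun p _ => W.bhatt_nonneg _ _)

theorem bhatt_le_Z (W : Channel X) {x x' : X} (h : x ≠ x') :
    W.bhatt x x' ≤ (Fintype.card X : ℝ) * ((Fintype.card X : ℝ) - 1) * W.Z := by
  rw [Z_eq_offDiag, ← card_offDiag_univ X]
  have hmem : (x, x') ∈ (Finset.univ : Finset X).offDiag := by simp [h]
  have hpos : 0 < ((Finset.univ : Finset X).offDiag.card : ℝ) := by
    exact_mod_cast Finset.card_pos.2 ⟨_, hmem⟩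
  rw [← mul_assoc, mul_one_div_cancel hpos.ne', one_mul]
  exact Finset.single_le_sum (f := fun p : X × X => W.bhatt p.1 p.2)
    (fun p _ => W.bhatt_nonneg _ _) hmem

theorem Z_le [Nontrivial X] (W : Channel X) {z : ℝ} (hz : ∀ x x', x ≠ x' → W.bhatt x x' ≤ z) :
    W.Z ≤ z := by
  rw [Z_eq_offDiag, ← card_offDiag_univ X]
  obtain ⟨x, x', h⟩ := exists_pair_ne X
  have hpos : 0 < ((Finset.univ : Finset X).offDiag.card : ℝ) := by
    exact_mod_cast Finset.card_pos.2 ⟨(x, x'), by simp [h]⟩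
  rw [one_div, inv_mul_le_iff₀ hpos, ← nsmul_eq_mul]
  exact Finset.sum_le_card_nsmul _ _ _ fun p hp => hz _ _ (Finset.mem_offDiag.1 hp).2.2

theorem le_Z [Nontrivial X] (W : Channel X) {z : ℝ} (hz : ∀ x x', x ≠ x' → z ≤ W.bhatt x x') :
    z ≤ W.Z := by
  rw [Z_eq_offDiag, ← card_offDiag_univ X]
  obtain ⟨x, x', h⟩ := exists_pair_ne X
  have hpos : 0 < ((Finset.univ : Finset X).offDiag.card : ℝ) := by
    exact_mod_cast Finset.card_pos.2 ⟨(x, x'), by simp [h]⟩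
  rw [one_div, le_inv_mul_iff₀ hpos, ← nsmul_eq_mul]
  exact Finset.card_nsmul_le_sum _ _ _ fun p hp => hz _ _ (Finset.mem_offDiag.1 hp).2.2

end Average

end Channel

/-- By symmetry a binary channel has only one off-diagonal parameter, so a nonzero average makes all
of them positive. -/
theorem bhatt_pos_of_Z_ne_zero (W : Channel Bit) (hW : W.Z ≠ 0) (x x' : Bit) :
    0 < W.bhatt x x' := by
  have key : ∀ x x' : Bit, x ≠ x' → W.bhatt x x' = W.bhatt 0 1 := by
    intro x x' h
    fin_cases x <;> fin_cases x' <;> first | exact absurd rfl h | rfl | exact W.bhatt_comm _ _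
  have h01 : 0 < W.bhatt 0 1 := by
    refine lt_of_le_of_ne (W.bhatt_nonneg _ _) fun h0 => hW ?_
    exact le_antisymm (W.Z_le fun x x' h => (key x x' h).trans_le h0.ge) W.Z_nonneg
  by_cases h : x = x'
  · rw [h, W.bhatt_self]
    exact one_pos
  · rw [key x x' h]
    exact h01

/-! ### Partial distances of a quaternary kernel -/

theorem assemble_self (i : Fin 4) (a : {j : Fin 4 // j < i} → Pair) (x : Pair)
    (c : {j : Fin 4 // i < j} → Pair) : assemble i a x c i = x := by
  simp [assemble]

theorem partialDistMin_le (g : QuatKernel) (i : Fin 4) {x x' : Pair} (h : x ≠ x')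
    (a : {j : Fin 4 // j < i} → Pair) (c c' : {j : Fin 4 // i < j} → Pair) :
    partialDistMin g i ≤ hammingDist (g (assemble i a x c)) (g (assemble i a x' c')) :=
  (ciInf_le (OrderBot.bddBelow _) (⟨(x, x'), h⟩ : {p : Pair × Pair // p.1 ≠ p.2})).trans <|
    (ciInf_le (OrderBot.bddBelow _) a).trans
      (ciInf_le (OrderBot.bddBelow _) (c, c'))

theorem exists_partialDist_eq (g : QuatKernel) (i : Fin 4) (x x' : Pair) :
    ∃ a c c', hammingDist (g (assemble i a x c)) (g (assemble i a x' c')) = partialDist g i x x' := by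
  obtain ⟨a, ha⟩ := ciInf_mem fun v : {j : Fin 4 // j < i} → Pair => partialDistAt g i x x' v
  obtain ⟨w, hw⟩ := ciInf_mem fun w : ({j : Fin 4 // i < j} → Pair) × ({j : Fin 4 // i < j} → Pair) =>
    hammingDist (g (assemble i a x w.1)) (g (assemble i a x' w.2))
  exact ⟨a, w.1, w.2, hw.trans ha⟩

theorem partialDist_le_max (g : QuatKernel) (i : Fin 4) (x x' : Pair) :
    partialDist g i x x' ≤ partialDistMax g i :=
  le_ciSup (f := fun p : Pair × Pair => partialDist g i p.1 p.2) (Set.finite_range _).bddAbove (x, x')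

theorem one_le_partialDist (g : QuatKernel) (i : Fin 4) {x x' : Pair} (h : x ≠ x') :
    1 ≤ partialDist g i x x' := by
  obtain ⟨a, c, c', hd⟩ := exists_partialDist_eq g i x x'
  rw [← hd, Nat.one_le_iff_ne_zero, hammingDist_ne_zero, g.injective.ne_iff]
  intro he
  have := congrFun he i
  rw [assemble_self, assemble_self] at this
  exact h this

theorem one_le_partialDistMin (g : QuatKernel) (i : Fin 4) : 1 ≤ partialDistMin g i := by
  -- An infimum over an empty family in `ℕ` would be 0.
  have : Nonempty {p : Pair × Pair // p.1 ≠ p.2} := ⟨⟨((0, 0), (0, 1)), by decide⟩⟩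
  exact le_ciInf fun p => one_le_partialDist g i p.2

theorem one_le_partialDistMax (g : QuatKernel) (i : Fin 4) : 1 ≤ partialDistMax g i :=
  (one_le_partialDist g i (x := (0, 0)) (x' := (0, 1)) (by decide)).trans (partialDist_le_max g i _ _)

theorem card_pair_fun (ι : Type) [Fintype ι] [DecidableEq ι] :
    (Fintype.card (ι → Pair) : ℝ) = 4 ^ Fintype.card ι := by
  simp

theorem card_lt_add_card_gt (i : Fin 4) :
    Fintype.card {j : Fin 4 // j < i} + Fintype.card {j : Fin 4 // i < j} = 3 := by
  revert i; decide

/-- There are 12 = 4·3 ordered pairs of distinct letters, so 12 Z bounds each parameter. After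
normalization the sum over previous and later inputs contributes the number of later inputs, at most
4³ = 64, and 768 = 12·64. The hypothesis lets every Hamming distance be lowered to the minimum. -/
theorem Z_quatSplit_le (g : QuatKernel) (W : Channel Pair) (i : Fin 4) (hW : 12 * W.Z ≤ 1) :
    12 * (quatSplit g W i).Z ≤ 768 * (12 * W.Z) ^ partialDistMin g i := by
  have hZ := W.Z_nonneg
  have hb : ∀ x x', x ≠ x' → W.bhatt x x' ≤ 12 * W.Z := by
    intro x x' h
    have := W.bhatt_le_Z h
    norm_num at this
    exact this
  suffices h : (quatSplit g W i).Z ≤ 64 * (12 * W.Z) ^ partialDistMin g i by linarith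
  refine Channel.Z_le _ fun x x' h => (W.bhatt_split_le _ x x').trans ?_
  have hcard := card_lt_add_card_gt i
  calc _ ≤ ∑ _a : {j : Fin 4 // j < i} → Pair, ∑ _c : {j : Fin 4 // i < j} → Pair,
        ∑ _c' : {j : Fin 4 // i < j} → Pair,
        (1 / ((Fintype.card ({j : Fin 4 // j < i} → Pair) : ℝ) *
          (Fintype.card ({j : Fin 4 // i < j} → Pair) : ℝ))) *
          (12 * W.Z) ^ partialDistMin g i := by
        refine Finset.sum_le_sum fun a _ => Finset.sum_le_sum fun c _ =>
          Finset.sum_le_sum fun c' _ => mul_le_mul_of_nonneg_left ?_ (by positivity)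
        exact (W.prod_bhatt_le hb _ _).trans
          (pow_le_pow_of_le_one (by positivity) hW (partialDistMin_le g i h a c c'))
    _ = (Fintype.card ({j : Fin 4 // i < j} → Pair) : ℝ) * (12 * W.Z) ^ partialDistMin g i := by
        simp only [Finset.sum_const, Finset.card_univ, nsmul_eq_mul]
        field_simp
    _ ≤ 64 * (12 * W.Z) ^ partialDistMin g i := by
        refine mul_le_mul_of_nonneg_right ?_ (by positivity)
        rw [card_pair_fun]
        calc (4 : ℝ) ^ Fintype.card {j : Fin 4 // i < j} ≤ 4 ^ 3 :=
              pow_le_pow_right₀ (by norm_num) (by omega)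
          _ = 64 := by norm_num

/-- Keep only the term attaining the partial distance; the three other positions give the
normalization 4³ = 64. A lower bound valid for every pair is propagated, since the average alone
does not control the smallest parameter. -/
theorem le_bhatt_quatSplit (g : QuatKernel) (W : Channel Pair) (i : Fin 4) {z : ℝ} (hz0 : 0 ≤ z)
    (hz1 : z ≤ 1) (hz : ∀ x x', x ≠ x' → z ≤ W.bhatt x x') (x x' : Pair) :
    z ^ partialDistMax g i / 64 ≤ (quatSplit g W i).bhatt x x' := by
  obtain ⟨a, c, c', hd⟩ := exists_partialDist_eq g i x x'
  refine le_trans ?_ (W.le_bhatt_split _ x x' a c c')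
  have hcard := card_lt_add_card_gt i
  rw [card_pair_fun, card_pair_fun, ← pow_add, hcard, div_eq_inv_mul]
  norm_num only
  refine mul_le_mul_of_nonneg_left ?_ (by norm_num)
  refine le_trans ?_ (W.pow_hammingDist_le_prod_bhatt hz0 hz _ _)
  rw [hd]
  exact pow_le_pow_of_le_one hz0 hz1 (partialDist_le_max g i x x')

/-! ### Unnormalized conditional entropy -/

/-- The entropy (in nats) of the nonnegative vector `p`, relative to its total mass. -/
def condEnt {X : Type} [Fintype X] (p : X → ℝ) : ℝ :=
  ∑ x, Real.negMulLog (p x) - Real.negMulLog (∑ x, p x)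

theorem hasSum_mul_of_nonneg {X X' : Type} {f : X → ℝ} {g : X' → ℝ} {s t : ℝ} (hf : ∀ x, 0 ≤ f x)
    (hg : ∀ z, 0 ≤ g z) (hs : HasSum f s) (ht : HasSum g t) :
    HasSum (fun z : X × X' => f z.1 * g z.2) (s * t) :=
  hs.mul ht (Summable.mul_of_nonneg hs.summable ht.summable hf hg)

section CondEnt

variable {X X' : Type} [Fintype X] [Fintype X']

theorem condEnt_comp_equiv (e : X' ≃ X) (p : X → ℝ) : condEnt (fun z => p (e z)) = condEnt p := by
  simp only [condEnt]
  rw [e.sum_comp p, e.sum_comp fun x => Real.negMulLog (p x)]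

/-- Additivity of entropy for independent components, without normalizing the masses. -/
theorem condEnt_prod_mul (p : X → ℝ) (r : X' → ℝ) :
    condEnt (fun z : X × X' => p z.1 * r z.2) =
      condEnt p * ∑ z, r z + (∑ x, p x) * condEnt r := by
  simp only [condEnt, Fintype.sum_prod_type, Real.negMulLog_mul, ← Finset.mul_sum,
    ← Finset.sum_mul, Finset.sum_add_distrib]
  ring

theorem condEnt_eq_sum_log (p : X → ℝ) (hp : ∀ x, 0 ≤ p x) :
    condEnt p = ∑ x, p x * Real.log ((∑ x', p x') / p x) := by
  have h : Real.negMulLog (∑ x, p x) = ∑ x, p x * -Real.log (∑ x', p x') := by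
    rw [← Finset.sum_mul, Real.negMulLog]
    ring
  rw [condEnt, h, ← Finset.sum_sub_distrib]
  refine Finset.sum_congr rfl fun x _ => ?_
  rcases (hp x).eq_or_lt with h0 | h0
  · simp [← h0]
  · have hP : 0 < ∑ x', p x' :=
      h0.trans_le (Finset.single_le_sum (fun x _ => hp x) (Finset.mem_univ x))
    rw [Real.log_div hP.ne' h0.ne', Real.negMulLog]
    ring

/-- This is log u ≥ 1 - 1/u; summed over `x`, it bounds the entropy below by a quadratic expression.
-/
theorem mul_one_sub_div_le (p : X → ℝ) (hp : ∀ x, 0 ≤ p x) (x : X) :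
    p x * (1 - p x / ∑ x', p x') ≤ p x * Real.log ((∑ x', p x') / p x) := by
  rcases (hp x).eq_or_lt with h0 | h0
  · simp [← h0]
  · have hP : 0 < ∑ x', p x' :=
      h0.trans_le (Finset.single_le_sum (fun x _ => hp x) (Finset.mem_univ x))
    refine mul_le_mul_of_nonneg_left ?_ h0.le
    have := Real.one_sub_inv_le_log_of_pos (div_pos hP h0)
    rwa [inv_div] at this

theorem mul_one_sub_div_nonneg (p : X → ℝ) (hp : ∀ x, 0 ≤ p x) (x : X) :
    0 ≤ p x * (1 - p x / ∑ x', p x') := by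
  refine mul_nonneg (hp x) (sub_nonneg.2 (div_le_one_of_le₀ ?_ (Finset.sum_nonneg fun x _ => hp x)))
  exact Finset.single_le_sum (fun x _ => hp x) (Finset.mem_univ x)

theorem condEnt_nonneg (p : X → ℝ) (hp : ∀ x, 0 ≤ p x) : 0 ≤ condEnt p := by
  rw [condEnt_eq_sum_log p hp]
  exact Finset.sum_nonneg fun x _ =>
    (mul_one_sub_div_nonneg p hp x).trans (mul_one_sub_div_le p hp x)

theorem two_mul_div_le_condEnt (p : X → ℝ) (hp : ∀ x, 0 ≤ p x) {x x' : X} (h : x ≠ x') :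
    2 * (p x * p x' / ∑ z, p z) ≤ condEnt p := by
  classical
  rw [condEnt_eq_sum_log p hp]
  have hsub : ∑ z ∈ ({x, x'} : Finset X), p z * (1 - p z / ∑ x', p x') ≤
      ∑ z, p z * Real.log ((∑ x', p x') / p z) :=
    (Finset.sum_le_univ_sum_of_nonneg fun z => mul_one_sub_div_nonneg p hp z).trans
      (Finset.sum_le_sum fun z _ => mul_one_sub_div_le p hp z)
  refine le_trans ?_ hsub
  rw [Finset.sum_pair h]
  have hP : p x + p x' ≤ ∑ z, p z := by
    rw [← Finset.sum_pair h]
    exact Finset.sum_le_univ_sum_of_nonneg hp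
  rcases (add_nonneg (hp x) (hp x')).eq_or_lt with h0 | h0
  · have h1 : p x = 0 := by linarith [hp x, hp x']
    have h2 : p x' = 0 := by linarith [hp x, hp x']
    simp [h1, h2]
  · have hP0 : 0 < ∑ z, p z := h0.trans_le hP
    set P := ∑ z, p z
    have e1 : p x * (1 - p x / P) + p x' * (1 - p x' / P) - 2 * (p x * p x' / P)
        = (p x + p x') * (P - (p x + p x')) / P := by
      field_simp
      ring
    have e2 : 0 ≤ (p x + p x') * (P - (p x + p x')) / P :=
      div_nonneg (mul_nonneg h0.le (sub_nonneg.2 hP)) hP0.le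
    linarith

/-- With P the total mass, write p p' = (p p'/P)·P and apply the arithmetic-geometric inequality
with weight `t`, then `two_mul_div_le_condEnt`. The bound is linear in entropy and mass, so it can
be summed over outputs, with `t` chosen afterwards. -/
theorem sqrt_mul_le_condEnt (p : X → ℝ) (hp : ∀ x, 0 ≤ p x) {x x' : X} (h : x ≠ x') {t : ℝ}
    (ht : 0 < t) : √(p x * p x') ≤ condEnt p / (4 * t) + t / 2 * ∑ z, p z := by
  have h2 := two_mul_div_le_condEnt p hp h
  have hP : p x ≤ ∑ z, p z := Finset.single_le_sum (fun x _ => hp x) (Finset.mem_univ x)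
  set P := ∑ z, p z
  have hc : p x * p x' / P / (2 * t) ≤ condEnt p / (4 * t) := by
    rw [div_le_div_iff₀ (by positivity) (by positivity)]
    nlinarith
  refine le_trans ?_ (add_le_add_left hc _)
  have hPnn : 0 ≤ P := (hp x).trans hP
  rcases hPnn.eq_or_lt with h0 | h0
  · have : p x = 0 := le_antisymm (by linarith) (hp x)
    simp [this, ← h0]
  · have hx := hp x
    have hx' := hp x'
    refine (Real.sqrt_le_left (by positivity)).2 ?_
    have e : (p x * p x' / P / (2 * t) + t / 2 * P) ^ 2 =
        (p x * p x' / P / (2 * t) - t / 2 * P) ^ 2 + p x * p x' := by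
      field_simp
      ring
    rw [e]
    nlinarith [sq_nonneg (p x * p x' / P / (2 * t) - t / 2 * P)]

/-- `P log q - condEnt p` is a divergence from the uniform vector, bounded below
by squared Hellinger terms. -/
theorem sq_sub_sqrt_le (p : X → ℝ) (hp : ∀ x, 0 ≤ p x) (x : X) :
    (√(p x) - √((∑ z, p z) / Fintype.card X)) ^ 2 ≤
      p x * Real.log (p x / ((∑ z, p z) / Fintype.card X)) - p x +
        (∑ z, p z) / Fintype.card X := by
  have hP : p x ≤ ∑ z, p z := Finset.single_le_sum (fun x _ => hp x) (Finset.mem_univ x)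
  have hq : 0 < (Fintype.card X : ℝ) := by
    exact_mod_cast Fintype.card_pos_iff.2 ⟨x⟩
  have hm : 0 ≤ (∑ z, p z) / Fintype.card X := div_nonneg ((hp x).trans hP) hq.le
  set m := (∑ z, p z) / (Fintype.card X : ℝ) with hmdef
  rcases (hp x).eq_or_lt with h0 | h0
  · simp [← h0, Real.sq_sqrt hm]
  · have hm0 : 0 < m := div_pos (h0.trans_le hP) hq
    have e : (√(p x) - √m) ^ 2 = p x + m - 2 * (√(p x) * √m) := by
      rw [sub_sq, Real.sq_sqrt h0.le, Real.sq_sqrt hm]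
      ring
    -- Applying log u ≥ 1 - 1/u at u = √(p/m) yields p log(p/m) ≥ 2p - 2√(pm).
    have hl := Real.one_sub_inv_le_log_of_pos (Real.sqrt_pos.2 (div_pos h0 hm0))
    rw [Real.log_sqrt (div_pos h0 hm0).le] at hl
    have e3 : p x * (√(p x / m))⁻¹ = √(p x) * √m := by
      rw [Real.sqrt_div h0.le, inv_div]
      have := Real.sqrt_pos.2 h0
      field_simp
      rw [Real.sq_sqrt h0.le]
    have e4 : p x * (1 - (√(p x / m))⁻¹) ≤ p x * (Real.log (p x / m) / 2) :=
      mul_le_mul_of_nonneg_left hl h0.le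
    rw [mul_sub, e3] at e4
    rw [e]
    linarith

/-- The corrections -p + m cancel in the sum; they are inserted so that each summand is nonnegative
by itself. -/
theorem sum_mul_log_card_sub_condEnt (p : X → ℝ) (hp : ∀ x, 0 ≤ p x) [Nonempty X] :
    (∑ x, p x) * Real.log (Fintype.card X) - condEnt p =
      ∑ x, (p x * Real.log (p x / ((∑ z, p z) / Fintype.card X)) - p x +
        (∑ z, p z) / Fintype.card X) := by
  have hq : 0 < (Fintype.card X : ℝ) := by exact_mod_cast Fintype.card_pos
  rw [Finset.sum_add_distrib, Finset.sum_sub_distrib, Finset.sum_const, Finset.card_univ,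
    nsmul_eq_mul, mul_div_cancel₀ _ hq.ne', sub_add_cancel, condEnt_eq_sum_log p hp,
    Finset.sum_mul, ← Finset.sum_sub_distrib]
  refine Finset.sum_congr rfl fun x _ => ?_
  rcases (hp x).eq_or_lt with h0 | h0
  · simp [← h0]
  · have hP : 0 < ∑ x', p x' :=
      h0.trans_le (Finset.single_le_sum (fun x _ => hp x) (Finset.mem_univ x))
    rw [Real.log_div hP.ne' h0.ne', Real.log_div h0.ne' (by positivity), Real.log_div hP.ne' hq.ne']
    ring

theorem condEnt_le (p : X → ℝ) (hp : ∀ x, 0 ≤ p x) [Nonempty X] :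
    condEnt p ≤ (∑ x, p x) * Real.log (Fintype.card X) := by
  rw [← sub_nonneg, sum_mul_log_card_sub_condEnt p hp]
  exact Finset.sum_nonneg fun x _ => (sq_nonneg _).trans (sq_sub_sqrt_le p hp x)

/-- Keep two Hellinger terms and use (a-c)² + (b-c)² ≥ (a-b)²/2 for the square roots a, b of the two
weights. -/
theorem half_add_sub_sqrt_le (p : X → ℝ) (hp : ∀ x, 0 ≤ p x) {x x' : X} (h : x ≠ x') :
    (p x + p x') / 2 - √(p x * p x') ≤
      (∑ x, p x) * Real.log (Fintype.card X) - condEnt p := by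
  classical
  have : Nonempty X := ⟨x⟩
  rw [sum_mul_log_card_sub_condEnt p hp]
  have hsub := (Finset.sum_le_univ_sum_of_nonneg (s := ({x, x'} : Finset X))
    fun z => sq_nonneg (√(p z) - √((∑ z, p z) / Fintype.card X))).trans
      (Finset.sum_le_sum fun z _ => sq_sub_sqrt_le p hp z)
  refine le_trans ?_ hsub
  rw [Finset.sum_pair h, Real.sqrt_mul (hp x)]
  have h1 := Real.sq_sqrt (hp x)
  have h2 := Real.sq_sqrt (hp x')
  nlinarith [sq_nonneg (√(p x) - √((∑ z, p z) / Fintype.card X) +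
    (√(p x') - √((∑ z, p z) / Fintype.card X)))]

theorem hasSum_condEnt_pi {Y : Type} (p : Y → X → ℝ) (hp : ∀ y x, 0 ≤ p y x)
    (h1 : HasSum (fun y => ∑ x, p y x) 1) {H : ℝ} (hH : HasSum (fun y => condEnt (p y)) H) (n : ℕ) :
    HasSum (fun y : Fin n → Y => condEnt fun u : Fin n → X => ∏ j, p (y j) (u j)) (n * H) := by
  induction n with
  | zero => simp [condEnt, Real.negMulLog]
  | succ n ih =>
    have hs := hasSum_pi_prod_of_nonneg n (fun _ y => ∑ x, p y x) (fun _ => 1)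
      (fun _ y => Finset.sum_nonneg fun x _ => hp y x) (fun _ => h1)
    rw [Finset.prod_const_one] at hs
    have hF0 : ∀ y : Fin n → Y, 0 ≤ ∏ j, ∑ x, p (y j) x := fun y =>
      Finset.prod_nonneg fun j _ => Finset.sum_nonneg fun x _ => hp _ x
    have hG0 : ∀ y : Fin n → Y, 0 ≤ condEnt fun u : Fin n → X => ∏ j, p (y j) (u j) := fun y =>
      condEnt_nonneg _ fun u => Finset.prod_nonneg fun j _ => hp _ _
    have hE0 : ∀ y, 0 ≤ condEnt (p y) := fun y => condEnt_nonneg _ (hp y)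
    have hS0 : ∀ y, 0 ≤ ∑ x, p y x := fun y => Finset.sum_nonneg fun x _ => hp y x
    have key : ∀ (y0 : Y) (y : Fin n → Y),
        condEnt (fun u : Fin (n + 1) → X =>
          ∏ j, p ((Fin.cons y0 y : Fin (n + 1) → Y) j) (u j)) =
        condEnt (p y0) * (∏ j, ∑ x, p (y j) x) + (∑ x, p y0 x) *
          condEnt fun u : Fin n → X => ∏ j, p (y j) (u j) := by
      intro y0 y
      rw [← condEnt_comp_equiv (Fin.consEquiv fun _ : Fin (n + 1) => X), Fintype.prod_sum,
        ← condEnt_prod_mul]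
      congr 1
      funext z
      rw [Fin.prod_univ_succ]
      rfl
    have hm := (hasSum_mul_of_nonneg hE0 hF0 hH hs).add (hasSum_mul_of_nonneg hS0 hG0 h1 ih)
    rw [← (Fin.consEquiv (fun _ : Fin (n + 1) => Y)).hasSum_iff]
    have e : ((n + 1 : ℕ) : ℝ) * H = H * 1 + 1 * (n * H) := by
      push_cast
      ring
    rw [e]
    exact hm.congr_fun fun z => key z.1 z.2

end CondEnt

/-! ### Entropy and information, compared with Bhattacharyya parameters -/

namespace Channel

variable {X : Type} [Fintype X]

/-- The joint weight of a uniform input and the output `y`. -/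
def joint (W : Channel X) (y : W.Out) (x : X) : ℝ := W.prob x y / Fintype.card X

theorem joint_nonneg (W : Channel X) (y : W.Out) (x : X) : 0 ≤ W.joint y x :=
  div_nonneg (W.prob_nonneg _ _) (Nat.cast_nonneg _)

/-- The conditional entropy (in nats) of a uniform input given the output. -/
def entropy (W : Channel X) : ℝ := ∑' y, condEnt (W.joint y)

theorem entropy_nonneg (W : Channel X) : 0 ≤ W.entropy :=
  tsum_nonneg fun y => condEnt_nonneg _ (W.joint_nonneg y)

variable [Nonempty X]

theorem hasSum_joint (W : Channel X) : HasSum (fun y => ∑ x, W.joint y x) 1 := by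
  have := hasSum_sum (s := (Finset.univ : Finset X)) fun x _ =>
    (W.hasSum_prob x).div_const (Fintype.card X : ℝ)
  have e : ∑ _x : X, 1 / (Fintype.card X : ℝ) = 1 := by
    rw [Finset.sum_const, Finset.card_univ, nsmul_eq_mul, mul_one_div_cancel]
    exact_mod_cast Fintype.card_ne_zero
  rwa [e] at this

theorem summable_condEnt (W : Channel X) : Summable fun y => condEnt (W.joint y) :=
  Summable.of_nonneg_of_le (fun y => condEnt_nonneg _ (W.joint_nonneg y))
    (fun y => condEnt_le _ (W.joint_nonneg y)) (W.hasSum_joint.summable.mul_right _)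

theorem hasSum_condEnt (W : Channel X) : HasSum (fun y => condEnt (W.joint y)) W.entropy :=
  W.summable_condEnt.hasSum

theorem hasSum_mul_log_card_sub (W : Channel X) :
    HasSum (fun y => (∑ x, W.joint y x) * Real.log (Fintype.card X) - condEnt (W.joint y))
      (Real.log (Fintype.card X) - W.entropy) := by
  simpa using (W.hasSum_joint.mul_right (Real.log (Fintype.card X))).sub W.hasSum_condEnt

theorem entropy_le (W : Channel X) : W.entropy ≤ Real.log (Fintype.card X) :=
  sub_nonneg.1 <| W.hasSum_mul_log_card_sub.nonneg fun y =>
    sub_nonneg.2 (condEnt_le _ (W.joint_nonneg y))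

theorem info_mul_log_two (W : Channel X) :
    W.info * Real.log 2 = Real.log (Fintype.card X) - W.entropy := by
  rw [← W.hasSum_mul_log_card_sub.tsum_eq, info, ← tsum_mul_right]
  refine tsum_congr fun y => ?_
  have hq : 0 < (Fintype.card X : ℝ) := by exact_mod_cast Fintype.card_pos
  have hl : Real.log 2 ≠ 0 := (Real.log_pos (by norm_num)).ne'
  have hj : ∀ x, 1 / (Fintype.card X : ℝ) * W.prob x y = W.joint y x := fun x => by
    rw [joint]; ring
  simp only [hj]
  rw [condEnt_eq_sum_log _ (W.joint_nonneg y), Finset.sum_mul, Finset.sum_mul,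
    ← Finset.sum_sub_distrib]
  refine Finset.sum_congr rfl fun x _ => ?_
  have hprob : W.prob x y = W.joint y x * Fintype.card X := by
    rw [joint, div_mul_cancel₀ _ hq.ne']
  rcases (W.joint_nonneg y x).eq_or_lt with h0 | h0
  · simp [← h0]
  · have hP : 0 < ∑ x', W.joint y x' :=
      h0.trans_le (Finset.single_le_sum (fun x _ => W.joint_nonneg y x) (Finset.mem_univ x))
    rw [hprob, Real.logb, Real.log_div (by positivity) hP.ne', Real.log_mul h0.ne' hq.ne',
      Real.log_div hP.ne' h0.ne']
    field_simp
    ring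

theorem bhatt_le_entropy (W : Channel X) {x x' : X} (h : x ≠ x') {t : ℝ} (ht : 0 < t) :
    W.bhatt x x' ≤ Fintype.card X * (W.entropy / (4 * t) + t / 2) := by
  have hs := ((W.hasSum_condEnt.div_const (4 * t)).add (W.hasSum_joint.mul_left (t / 2))).mul_left
    (Fintype.card X : ℝ)
  rw [mul_one] at hs
  rw [← hs.tsum_eq]
  refine (W.summable_sqrt x x').tsum_le_tsum (fun y => ?_) hs.summable
  have hq : 0 < (Fintype.card X : ℝ) := by exact_mod_cast Fintype.card_pos
  have := mul_le_mul_of_nonneg_left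
    (sqrt_mul_le_condEnt (W.joint y) (W.joint_nonneg y) h ht) hq.le
  refine le_trans (le_of_eq ?_) this
  have e : W.prob x y * W.prob x' y =
      (Fintype.card X : ℝ) ^ 2 * (W.joint y x * W.joint y x') := by
    simp only [joint]
    field_simp
  rw [e, Real.sqrt_mul (by positivity), Real.sqrt_sq hq.le]

theorem one_sub_bhatt_le (W : Channel X) {x x' : X} (h : x ≠ x') :
    1 - W.bhatt x x' ≤ Fintype.card X * (W.info * Real.log 2) := by
  have hs := W.hasSum_mul_log_card_sub.mul_left (Fintype.card X : ℝ)
  have hb := (((W.hasSum_prob x).add (W.hasSum_prob x')).div_const 2).sub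
    (W.summable_sqrt x x').hasSum
  rw [one_add_one_eq_two, div_self two_ne_zero] at hb
  rw [info_mul_log_two]
  refine hasSum_le (fun y => ?_) hb hs
  have hq : 0 < (Fintype.card X : ℝ) := by exact_mod_cast Fintype.card_pos
  have := mul_le_mul_of_nonneg_left (half_add_sub_sqrt_le (W.joint y) (W.joint_nonneg y) h) hq.le
  refine le_trans (le_of_eq ?_) this
  have e : W.prob x y * W.prob x' y =
      (Fintype.card X : ℝ) ^ 2 * (W.joint y x * W.joint y x') := by
    simp only [joint]
    field_simp
  have e' : ∀ x, W.prob x y = Fintype.card X * W.joint y x := fun x => by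
    simp only [joint]
    field_simp
  rw [e, Real.sqrt_mul (by positivity), Real.sqrt_sq hq.le, e' x, e' x']
  ring

end Channel

/-! ### Conservation of information under splitting -/

namespace Channel

variable {X : Type} [Fintype X]

/-- The joint weight of a uniform input word and the output word `y`. -/
def jointWord (W : Channel X) (y : Fin 4 → W.Out) (u : Fin 4 → X) : ℝ := ∏ j, W.joint (y j) (u j)

/-- The cardinality condition makes the uniform weights on the split inputs agree with the uniform
weight on words, so the split joint law is a marginal of the word law. -/
theorem hasSum_condEnt_split (W : Channel X) {A B C : Type} [Fintype A] [Nonempty A] [Fintype B]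
    [Nonempty B] [Fintype C] [Nonempty C] (f : A → B → C → Fin 4 → X)
    (hcard : Fintype.card A * Fintype.card B * Fintype.card C = Fintype.card X ^ 4) :
    HasSum (fun y : Fin 4 → W.Out => ∑ a, condEnt fun b => ∑ c, W.jointWord y (f a b c))
      (W.split f).entropy := by
  have h := (W.split f).hasSum_condEnt
  have e : ∀ (y : Fin 4 → W.Out) (a : A), (W.split f).joint (y, a) =
      fun b => ∑ c, W.jointWord y (f a b c) := by
    intro y a
    funext b
    have hcard' : (Fintype.card A : ℝ) * Fintype.card B * Fintype.card C
        = (Fintype.card X : ℝ) ^ 4 := by exact_mod_cast hcard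
    have hA : (Fintype.card A : ℝ) ≠ 0 := by exact_mod_cast Fintype.card_ne_zero
    have hB : (Fintype.card B : ℝ) ≠ 0 := by exact_mod_cast Fintype.card_ne_zero
    have hC : (Fintype.card C : ℝ) ≠ 0 := by exact_mod_cast Fintype.card_ne_zero
    change (∑ c, 1 / ((Fintype.card A : ℝ) * Fintype.card C) * ∏ j, W.prob (f a b c j) (y j)) /
      (Fintype.card B : ℝ) = _
    rw [Finset.sum_div]
    refine Finset.sum_congr rfl fun c _ => ?_
    simp only [jointWord, joint]
    rw [Finset.prod_div_distrib, Finset.prod_const, Finset.card_univ, Fintype.card_fin, ← hcard']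
    field_simp
  have := HasSum.prod_fiberwise (f := fun o : (Fin 4 → W.Out) × A => condEnt ((W.split f).joint o))
    h fun y => hasSum_fintype _
  simp only [e] at this
  exact this

theorem hasSum_condEnt_jointWord [Nonempty X] (W : Channel X) :
    HasSum (fun y : Fin 4 → W.Out => condEnt (W.jointWord y)) (4 * W.entropy) := by
  exact_mod_cast hasSum_condEnt_pi W.joint W.joint_nonneg W.hasSum_joint W.hasSum_condEnt 4

end Channel

/-- The entropy chain rule for a triple. -/
theorem condEnt_chain_three {A B C : Type} [Fintype A] [Fintype B] [Fintype C]
    (F : A × B × C → ℝ) :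
    (condEnt fun a => ∑ z : B × C, F (a, z)) + (∑ a, condEnt fun b => ∑ c, F (a, b, c)) +
      (∑ z : A × B, condEnt fun c => F (z.1, z.2, c)) = condEnt F := by
  simp only [condEnt, Finset.sum_sub_distrib, Fintype.sum_prod_type]
  ring

/-! ### Chain rule through prefix masses -/

section Assemble

variable (i : Fin 4)

theorem assemble_of_lt (a : {j : Fin 4 // j < i} → Pair) (x : Pair)
    (c : {j : Fin 4 // i < j} → Pair) (j : Fin 4) (h : j < i) : assemble i a x c j = a ⟨j, h⟩ := by
  simp [assemble, h]

theorem assemble_of_gt (a : {j : Fin 4 // j < i} → Pair) (x : Pair)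
    (c : {j : Fin 4 // i < j} → Pair) (j : Fin 4) (h : i < j) : assemble i a x c j = c ⟨j, h⟩ := by
  simp [assemble, h, h.not_gt]

theorem assemble_bijective : Function.Bijective
    fun z : ({j : Fin 4 // j < i} → Pair) × Pair × ({j : Fin 4 // i < j} → Pair) =>
      assemble i z.1 z.2.1 z.2.2 := by
  constructor
  · rintro ⟨a, x, c⟩ ⟨a', x', c'⟩ h
    have h' : ∀ j, assemble i a x c j = assemble i a' x' c' j := congrFun h
    refine Prod.ext (funext fun j => ?_) (Prod.ext ?_ (funext fun j => ?_))
    · simpa [assemble_of_lt i _ _ _ _ j.2] using h' j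
    · simpa [assemble_self] using h' i
    · simpa [assemble_of_gt i _ _ _ _ j.2] using h' j
  · intro u
    refine ⟨(fun j => u j, u i, fun j => u j), funext fun j => ?_⟩
    rcases lt_trichotomy j i with h | h | h
    · exact assemble_of_lt i _ _ _ j h
    · rw [h]
      exact assemble_self i _ _ _
    · exact assemble_of_gt i _ _ _ j h

theorem sum_assemble (F : (Fin 4 → Pair) → ℝ) :
    ∑ u, F u = ∑ a, ∑ x, ∑ c, F (assemble i a x c) := by
  rw [← (Equiv.ofBijective _ (assemble_bijective i)).sum_comp F, Fintype.sum_prod_type]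
  refine Finset.sum_congr rfl fun a _ => ?_
  rw [Fintype.sum_prod_type]
  rfl

/-- The total weight of the words that agree with `u` in the first `k` positions. -/
def prefixMass (F : (Fin 4 → Pair) → ℝ) (k : ℕ) (u : Fin 4 → Pair) : ℝ :=
  ∑ u', if ∀ j : Fin 4, j.val < k → u' j = u j then F u' else 0

theorem prefixMass_assemble (F : (Fin 4 → Pair) → ℝ) (a : {j : Fin 4 // j < i} → Pair) (x : Pair)
    (c : {j : Fin 4 // i < j} → Pair) :
    prefixMass F i (assemble i a x c) = ∑ x', ∑ c', F (assemble i a x' c') := by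
  have key : ∀ a' x' c', (∀ j : Fin 4, j.val < i.val →
      assemble i a' x' c' j = assemble i a x c j) ↔ a' = a := by
    intro a' x' c'
    constructor
    · intro h
      funext j
      simpa [assemble_of_lt i _ _ _ _ j.2] using h j j.2
    · rintro rfl j hj
      rw [assemble_of_lt i _ _ _ j hj, assemble_of_lt i _ _ _ j hj]
  rw [prefixMass, sum_assemble i]
  simp only [key]
  rw [Finset.sum_eq_single a]
  · simp
  · intro a' _ h
    simp [h]
  · simp

theorem prefixMass_succ_assemble (F : (Fin 4 → Pair) → ℝ) (a : {j : Fin 4 // j < i} → Pair)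
    (x : Pair) (c : {j : Fin 4 // i < j} → Pair) :
    prefixMass F (i + 1) (assemble i a x c) = ∑ c', F (assemble i a x c') := by
  have key : ∀ a' x' c', (∀ j : Fin 4, j.val < i.val + 1 →
      assemble i a' x' c' j = assemble i a x c j) ↔ a' = a ∧ x' = x := by
    intro a' x' c'
    constructor
    · intro h
      constructor
      · funext j
        simpa [assemble_of_lt i _ _ _ _ j.2] using h j (Nat.lt_succ_of_lt j.2)
      · simpa [assemble_self] using h i (Nat.lt_succ_self _)
    · rintro ⟨rfl, rfl⟩ j hj
      rcases (Nat.lt_succ_iff.1 hj).lt_or_eq with h | h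
      · rw [assemble_of_lt i _ _ _ j h, assemble_of_lt i _ _ _ j h]
      · rw [Fin.ext h, assemble_self, assemble_self]
  rw [prefixMass, sum_assemble i]
  simp only [key]
  rw [Finset.sum_eq_single a, Finset.sum_eq_single x]
  · simp
  · intro x' _ h
    simp [h]
  · simp
  · intro a' _ h
    simp [h]
  · simp

/-- The index types of `a` and `c` vary with `i`. Rewriting both terms as sums over whole words puts
all four positions on the same index set, where they telescope. -/
theorem sum_condEnt_assemble (F : (Fin 4 → Pair) → ℝ) :
    ∑ a, condEnt (fun x => ∑ c, F (assemble i a x c)) =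
      ∑ u, F u * Real.log (prefixMass F i u) - ∑ u, F u * Real.log (prefixMass F (i + 1) u) := by
  rw [sum_assemble i fun u => F u * Real.log (prefixMass F i u),
    sum_assemble i fun u => F u * Real.log (prefixMass F (i + 1) u), ← Finset.sum_sub_distrib]
  refine Finset.sum_congr rfl fun a _ => ?_
  simp only [prefixMass_assemble, prefixMass_succ_assemble, ← Finset.sum_mul, condEnt,
    Real.negMulLog, Finset.sum_neg_distrib, neg_mul]
  ring

end Assemble

/-- The entropy chain rule for words of length four. -/
theorem condEnt_chain_assemble (F : (Fin 4 → Pair) → ℝ) :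
    ∑ i, ∑ a, condEnt (fun x => ∑ c, F (assemble i a x c)) = condEnt F := by
  simp only [sum_condEnt_assemble]
  have h0 : ∀ u, prefixMass F 0 u = ∑ u', F u' := fun u => by simp [prefixMass]
  have h4 : ∀ u, prefixMass F 4 u = F u := by
    intro u
    have key : ∀ u' : Fin 4 → Pair, (∀ j : Fin 4, j.val < 4 → u' j = u j) ↔ u' = u := fun u' =>
      ⟨fun h => funext fun j => h j j.2, fun h j _ => by rw [h]⟩
    simp only [prefixMass, key]
    simp
  rw [Fin.sum_univ_four]
  change (∑ u, F u * Real.log (prefixMass F 0 u) - ∑ u, F u * Real.log (prefixMass F 1 u)) +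
    (∑ u, F u * Real.log (prefixMass F 1 u) - ∑ u, F u * Real.log (prefixMass F 2 u)) +
    (∑ u, F u * Real.log (prefixMass F 2 u) - ∑ u, F u * Real.log (prefixMass F 3 u)) +
    (∑ u, F u * Real.log (prefixMass F 3 u) - ∑ u, F u * Real.log (prefixMass F 4 u)) = _
  simp only [h0, h4, condEnt, Real.negMulLog, ← Finset.sum_mul, neg_mul, Finset.sum_neg_distrib]
  ring

theorem sum_entropy_quatSplit (g : QuatKernel) (W : Channel Pair) :
    ∑ i, (quatSplit g W i).entropy = 4 * W.entropy := by
  have h : ∀ i, HasSum (fun y : Fin 4 → W.Out =>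
      ∑ a, condEnt fun x => ∑ c, W.jointWord y (g (assemble i a x c)))
      (quatSplit g W i).entropy := by
    intro i
    refine W.hasSum_condEnt_split (fun a x c => g (assemble i a x c)) ?_
    have := Fintype.card_of_bijective (assemble_bijective i)
    rw [Fintype.card_prod, Fintype.card_prod, ← mul_assoc] at this
    rw [this]
    simp
  refine (hasSum_sum (s := Finset.univ) fun i _ => h i).unique ?_
  convert W.hasSum_condEnt_jointWord using 1
  funext y
  rw [condEnt_chain_assemble fun u => W.jointWord y (g u), condEnt_comp_equiv g]

/-- Disjointness at each level of the partition recovers the inputs one after the other; both sides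
have 16 elements. -/
theorem CodeDecomposition.Induces.bijective {T : CodeDecomposition}
    {g : Bit → Pair → Bit → Word} (hg : T.Induces g) :
    Function.Bijective fun z : Bit × Pair × Bit => g z.1 z.2.1 z.2.2 := by
  have mem₄ : ∀ a p b, g a p b ∈ T.T₃ a p := fun a p b => by
    rw [← (T.partition₄ a p).2]
    exact Finset.mem_biUnion.2 ⟨b, Finset.mem_univ _, hg a p b⟩
  have mem₃ : ∀ a p b, g a p b ∈ T.T₂ a := fun a p b => by
    rw [← (T.partition₃ a).2]
    exact Finset.mem_biUnion.2 ⟨p, Finset.mem_univ _, mem₄ a p b⟩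
  rw [Fintype.bijective_iff_injective_and_card]
  refine ⟨?_, by simp⟩
  rintro ⟨a, p, b⟩ ⟨a', p', b'⟩ h
  change g a p b = g a' p' b' at h
  have ha : a = a' := by
    by_contra hne
    exact Finset.disjoint_left.1 (T.partition₂.1 hne) (mem₃ a p b) (h ▸ mem₃ a' p' b')
  subst ha
  have hp : p = p' := by
    by_contra hne
    exact Finset.disjoint_left.1 ((T.partition₃ a).1 hne) (mem₄ a p b) (h ▸ mem₄ a p' b')
  subst hp
  have hb : b = b' := by
    by_contra hne
    exact Finset.disjoint_left.1 ((T.partition₄ a p).1 hne) (hg a p b) (h ▸ hg a p b')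
  rw [hb]

theorem sum_entropy_binary {g : Bit → Pair → Bit → Word}
    (hg : Function.Bijective fun z : Bit × Pair × Bit => g z.1 z.2.1 z.2.2) (W : Channel Bit) :
    (binFirst g W).entropy + (binGlued g W).entropy + (binLast g W).entropy = 4 * W.entropy := by
  have h1 := W.hasSum_condEnt_split (fun (_ : Unit) (u₁ : Bit) (c : Pair × Bit) => g u₁ c.1 c.2)
    (by simp)
  have h2 := W.hasSum_condEnt_split (fun (u₁ : Bit) (u₂₃ : Pair) (u₄ : Bit) => g u₁ u₂₃ u₄)
    (by simp)
  have h3 := W.hasSum_condEnt_split (fun (a : Bit × Pair) (u₄ : Bit) (_ : Unit) => g a.1 a.2 u₄)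
    (by simp)
  refine ((h1.add h2).add h3).unique ?_
  convert W.hasSum_condEnt_jointWord using 1
  funext y
  rw [← condEnt_comp_equiv (Equiv.ofBijective _ hg), ← condEnt_chain_three]
  simp

theorem sum_info_quatSplit (g : QuatKernel) (W : Channel Pair) :
    ∑ i, (quatSplit g W i).info = 4 * W.info := by
  have hl : Real.log 2 ≠ 0 := (Real.log_pos (by norm_num)).ne'
  refine mul_right_cancel₀ hl ?_
  rw [Finset.sum_mul, mul_assoc]
  simp only [Channel.info_mul_log_two, Finset.sum_sub_distrib, sum_entropy_quatSplit]
  simp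
  ring

theorem info_binary {g : Bit → Pair → Bit → Word}
    (hg : Function.Bijective fun z : Bit × Pair × Bit => g z.1 z.2.1 z.2.2) (W : Channel Bit) :
    (binFirst g W).info + (binGlued g W).info + (binLast g W).info = 4 * W.info := by
  have hl : Real.log 2 ≠ 0 := (Real.log_pos (by norm_num)).ne'
  have h := sum_entropy_binary hg W
  have h4 : Real.log 4 = 2 * Real.log 2 := by
    rw [show (4 : ℝ) = 2 ^ 2 by norm_num, Real.log_pow]
    norm_num
  refine mul_right_cancel₀ hl ?_
  rw [add_mul, add_mul, mul_assoc]
  simp only [Channel.info_mul_log_two]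
  simp only [Fintype.card_fin, Fintype.card_prod]
  norm_num
  rw [h4]
  linarith

theorem info_nonneg {X : Type} [Fintype X] [Nonempty X] (W : Channel X) : 0 ≤ W.info := by
  have hl : 0 < Real.log 2 := Real.log_pos (by norm_num)
  refine le_of_mul_le_mul_right ?_ hl
  rw [zero_mul, Channel.info_mul_log_two]
  exact sub_nonneg.2 W.entropy_le

theorem info_bit_le (W : Channel Bit) : W.info ≤ 1 := by
  have hl : 0 < Real.log 2 := Real.log_pos (by norm_num)
  refine le_of_mul_le_mul_right ?_ hl
  rw [Channel.info_mul_log_two]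
  have := W.entropy_nonneg
  simp only [Fintype.card_fin]
  norm_num
  exact this

theorem entropy_pair (W : Channel Pair) : W.entropy = 2 * Real.log 2 * (1 - W.info / 2) := by
  have h := W.info_mul_log_two
  have h4 : Real.log 4 = 2 * Real.log 2 := by
    rw [show (4 : ℝ) = 2 ^ 2 by norm_num, Real.log_pow]
    norm_num
  simp only [Fintype.card_fin, Fintype.card_prod] at h
  norm_num at h
  linarith

theorem info_pair_le (W : Channel Pair) : W.info / 2 ≤ 1 := by
  have hl : 0 < Real.log 2 := Real.log_pos (by norm_num)
  have := W.entropy_nonneg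
  rw [entropy_pair] at this
  have := nonneg_of_mul_nonneg_right this (by positivity)
  linarith

/-- Noiseless limit: the Bhattacharyya parameter vanishes. -/
theorem tendsto_Z_of_info_tendsto_one {V : ℕ → Channel Pair}
    (h : Tendsto (fun n => (V n).info / 2) atTop (𝓝 1)) :
    Tendsto (fun n => (V n).Z) atTop (𝓝 0) := by
  have hH : Tendsto (fun n => (V n).entropy) atTop (𝓝 0) := by
    simp only [entropy_pair]
    have := (h.const_sub 1).const_mul (2 * Real.log 2)
    simpa using this
  rw [Metric.tendsto_atTop]
  intro ε hε
  -- With t = ε/4 the term that does not vanish is 4·t/2 = ε/2.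
  have ht : 0 < ε / 4 := by positivity
  have hb : Tendsto (fun n => 4 * ((V n).entropy / (4 * (ε / 4)) + ε / 4 / 2)) atTop
      (𝓝 (4 * (0 / (4 * (ε / 4)) + ε / 4 / 2))) :=
    ((hH.div_const _).add_const _).const_mul _
  have hlt : 4 * (0 / (4 * (ε / 4)) + ε / 4 / 2) < ε := by
    rw [zero_div, zero_add]
    linarith
  obtain ⟨N, hN⟩ := eventually_atTop.1 (hb.eventually (gt_mem_nhds hlt))
  refine ⟨N, fun n hn => ?_⟩
  rw [Real.dist_0_eq_abs, abs_of_nonneg (V n).Z_nonneg]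
  refine lt_of_le_of_lt ((V n).Z_le fun x x' hx => ?_) (hN n hn)
  have := (V n).bhatt_le_entropy hx ht
  simp only [Fintype.card_fin, Fintype.card_prod] at this
  norm_num only at this
  exact this

/-- Useless limit: the Bhattacharyya parameter is eventually above `1 / 2`. -/
theorem eventually_half_lt_Z {V : ℕ → Channel Pair}
    (h : Tendsto (fun n => (V n).info / 2) atTop (𝓝 0)) : ∀ᶠ n in atTop, 1 / 2 < (V n).Z := by
  have hb : Tendsto (fun n => 1 - 4 * (2 * ((V n).info / 2) * Real.log 2)) atTop
      (𝓝 (1 - 4 * (2 * 0 * Real.log 2))) :=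
    (((h.const_mul 2).mul_const _).const_mul 4).const_sub 1
  filter_upwards [hb.eventually (lt_mem_nhds (show (1 / 2 : ℝ) < _ by norm_num))] with n hn
  refine hn.trans_le ((V n).le_Z fun x x' hx => ?_)
  have := (V n).one_sub_bhatt_le hx
  simp only [Fintype.card_fin, Fintype.card_prod] at this
  norm_num at this
  linarith

/-! ### Growth of exponents along a path -/

theorem two_rpow_neg (x : ℝ) : (2 : ℝ) ^ (-x) = Real.exp (-(Real.log 2 * x)) := by
  rw [Real.rpow_def_of_pos (by norm_num), mul_neg]

/-- For L = -log z the recursion reads L(n+1) ≥ D L(n) - log C. Since L tends to infinity, the loss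
log C eventually costs less than a factor 4^(-ε), so log₄ L gains at least log₄ D - ε per step. -/
theorem eventually_le_of_le_mul_pow {z : ℕ → ℝ} {D : ℕ → ℕ} {C E β : ℝ} (hz0 : ∀ n, 0 ≤ z n)
    (hz : Tendsto z atTop (𝓝 0)) (hD : ∀ n, 1 ≤ D n) (hC : 1 ≤ C)
    (hrec : ∀ᶠ n in atTop, z (n + 1) ≤ C * z n ^ D n)
    (hS : Tendsto (fun n : ℕ => (∑ k ∈ Finset.range n, Real.logb 4 (D k)) / n) atTop (𝓝 E))
    (hβ : β < E) : ∀ᶠ n : ℕ in atTop, z n ≤ (2 : ℝ) ^ (-((4 : ℝ) ^ (β * (n : ℝ)))) := by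
  obtain ⟨N, hN⟩ := eventually_atTop.1 hrec
  -- A late zero persists, as D ≥ 1; otherwise logarithms are legitimate.
  by_cases hex : ∃ m, N ≤ m ∧ z m = 0
  · obtain ⟨m, hm, h0⟩ := hex
    refine eventually_atTop.2 ⟨m, fun n hn => ?_⟩
    have : z n = 0 := by
      induction n, hn using Nat.le_induction with
      | base => exact h0
      | succ n hn ih =>
        have := hN n (hm.trans hn)
        rw [ih, zero_pow (Nat.one_le_iff_ne_zero.1 (hD n)), mul_zero] at this
        exact le_antisymm this (hz0 _)
    rw [this]
    positivity
  · push Not at hex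
    -- One share each for the constant `C`, the convergence of averages, and the initial value `K`.
    set ε := (E - β) / 3 with hε
    have hε0 : 0 < ε := by rw [hε]; linarith
    set r : ℝ := (4 : ℝ) ^ (-ε) with hr
    have hr0 : 0 < r := by positivity
    have hr1 : r < 1 := Real.rpow_lt_one_of_one_lt_of_neg (by norm_num) (by linarith)
    have hlr : Real.logb 4 r = -ε := Real.logb_rpow (by norm_num) (by norm_num)
    have hlogC : 0 ≤ Real.log C := Real.log_nonneg hC
    -- Above this level log C ≤ (1 - r) L; the added 1 keeps `M` positive.
    set M := Real.log C / (1 - r) + 1 with hM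
    have hM0 : 0 < M := add_pos_of_nonneg_of_pos (div_nonneg hlogC (by linarith)) one_pos
    obtain ⟨N₁, hN₁⟩ := eventually_atTop.1
      ((hz.eventually (gt_mem_nhds (Real.exp_pos (-M)))).and (eventually_ge_atTop N))
    have hpos : ∀ n, N₁ ≤ n → 0 < z n := fun n hn =>
      (hz0 n).lt_of_ne' (hex n (hN₁ n hn).2)
    have ha : ∀ n, N₁ ≤ n → M < -Real.log (z n) := fun n hn => by
      have := Real.log_lt_log (hpos n hn) (hN₁ n hn).1
      rw [Real.log_exp] at this
      linarith
    have hstep : ∀ n, N₁ ≤ n →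
        Real.logb 4 (-Real.log (z n)) + Real.logb 4 (D n) - ε ≤
          Real.logb 4 (-Real.log (z (n + 1))) := by
      intro n hn
      have h1 := hN n (hN₁ n hn).2
      have hzn := hpos n hn
      have hDn : (1 : ℝ) ≤ D n := by exact_mod_cast hD n
      have h2 := Real.log_le_log (hpos (n + 1) (by omega)) h1
      rw [Real.log_mul (by positivity) (by positivity), Real.log_pow] at h2
      have h3 : Real.log C ≤ (1 - r) * -Real.log (z n) := by
        have : Real.log C / (1 - r) ≤ -Real.log (z n) := by linarith [ha n hn]
        rw [div_le_iff₀ (by linarith)] at this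
        linarith
      have han : 0 < -Real.log (z n) := hM0.trans (ha n hn)
      have h4 : -Real.log (z n) * D n * r ≤ -Real.log (z (n + 1)) := by nlinarith
      have h5 := Real.logb_le_logb_of_le (b := 4) (by norm_num) (by positivity) h4
      rw [Real.logb_mul (by positivity) hr0.ne', Real.logb_mul han.ne' (by positivity), hlr] at h5
      linarith
    have hsum : ∀ n, N₁ ≤ n →
        Real.logb 4 (-Real.log (z N₁)) - ∑ k ∈ Finset.range N₁, Real.logb 4 (D k) +
          ∑ k ∈ Finset.range n, Real.logb 4 (D k) - ε * (n - N₁) ≤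
          Real.logb 4 (-Real.log (z n)) := by
      intro n hn
      induction n, hn using Nat.le_induction with
      | base => simp
      | succ n hn ih =>
        have := hstep n hn
        rw [Finset.sum_range_succ]
        push_cast
        linarith
    set K := Real.logb 4 (-Real.log (z N₁)) - ∑ k ∈ Finset.range N₁, Real.logb 4 (D k) + ε * N₁
      with hK
    have hlin : ∀ᶠ n : ℕ in atTop, -K ≤ ε * n :=
      (tendsto_natCast_atTop_atTop.const_mul_atTop hε0).eventually_ge_atTop (-K)
    filter_upwards [hlin, eventually_ge_atTop N₁, eventually_gt_atTop 0,
      hS.eventually (lt_mem_nhds (show E - ε < E by linarith))] with n h1 h2 h3 h4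
    have hn : (0 : ℝ) < n := by exact_mod_cast h3
    rw [lt_div_iff₀ hn] at h4
    have h5 := hsum n h2
    have h6 : β * n ≤ Real.logb 4 (-Real.log (z n)) := by
      have : β = E - 3 * ε := by rw [hε]; ring
      rw [this]
      linarith
    have hzn := hpos n h2
    have han : 0 < -Real.log (z n) := hM0.trans (ha n h2)
    rw [Real.le_logb_iff_rpow_le (by norm_num) han] at h6
    rw [two_rpow_neg, ← Real.log_le_iff_le_exp hzn]
    have hl2 : Real.log 2 ≤ 1 := by linarith [Real.log_two_lt_d9]
    have h7 : 0 < (4 : ℝ) ^ (β * (n : ℝ)) := by positivity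
    nlinarith

theorem eventually_ge_of_exp_mul_prod_le {z : ℕ → ℝ} {D : ℕ → ℕ} {a C E β : ℝ}
    (hD : ∀ n, 1 ≤ D n)
    (hz : ∀ᶠ n : ℕ in atTop, Real.exp (-((a + n * C) * ∏ k ∈ Finset.range n, (D k : ℝ))) ≤ z n)
    (hS : Tendsto (fun n : ℕ => (∑ k ∈ Finset.range n, Real.logb 4 (D k)) / n) atTop (𝓝 E))
    (hβ : E < β) (ha : 0 ≤ a) (hC : 0 ≤ C) :
    ∀ᶠ n : ℕ in atTop, (2 : ℝ) ^ (-((4 : ℝ) ^ (β * (n : ℝ)))) ≤ z n := by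
  -- Half of the gap covers the averages; the other half absorbs the linear factor a + nC.
  set ε := (β - E) / 2 with hε
  have hε0 : 0 < ε := by rw [hε]; linarith
  set r : ℝ := (4 : ℝ) ^ (-ε) with hr
  have hr0 : 0 < r := by positivity
  have hr1 : r < 1 := Real.rpow_lt_one_of_one_lt_of_neg (by norm_num) (by linarith)
  have h1 := (tendsto_pow_atTop_nhds_zero_of_lt_one hr0.le hr1).const_mul a
  have h2 := (tendsto_self_mul_const_pow_of_lt_one hr0.le hr1).const_mul C
  have h3 := h1.add h2
  rw [mul_zero, mul_zero, add_zero] at h3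
  filter_upwards [hz, eventually_gt_atTop 0,
    h3.eventually (gt_mem_nhds (Real.log_pos one_lt_two)),
    hS.eventually (gt_mem_nhds (show E < E + ε by linarith))] with n hzn hn0 hlin hSn
  have hn : (0 : ℝ) < n := by exact_mod_cast hn0
  rw [div_lt_iff₀ hn] at hSn
  refine le_trans ?_ hzn
  rw [two_rpow_neg, Real.exp_le_exp, neg_le_neg_iff]
  have hprod : ∏ k ∈ Finset.range n, (D k : ℝ) ≤ (4 : ℝ) ^ ((E + ε) * n) := by
    rw [← Real.logb_le_iff_le_rpow (by norm_num)
      (Finset.prod_pos fun k _ => by exact_mod_cast hD k), Real.logb_prod]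
    · exact hSn.le
    · intro k _
      exact_mod_cast Nat.one_le_iff_ne_zero.1 (hD k)
  have hsplit : (4 : ℝ) ^ ((E + ε) * n) = (4 : ℝ) ^ (β * n) * r ^ n := by
    rw [hr, ← Real.rpow_mul_natCast (by norm_num), ← Real.rpow_add (by norm_num)]
    congr 1
    rw [hε]
    ring
  have hnn : 0 ≤ a + n * C := by positivity
  calc (a + n * C) * ∏ k ∈ Finset.range n, (D k : ℝ)
      ≤ (a + n * C) * ((4 : ℝ) ^ (β * n) * r ^ n) := by
        rw [← hsplit]
        exact mul_le_mul_of_nonneg_left hprod hnn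
    _ = (a * r ^ n + C * (n * r ^ n)) * (4 : ℝ) ^ (β * n) := by ring
    _ ≤ Real.log 2 * (4 : ℝ) ^ (β * n) := mul_le_mul_of_nonneg_right hlin.le (by positivity)

theorem one_le_prod_partialDistMax (g : QuatKernel) (b : ℕ → Fin 4) (s : Finset ℕ) :
    (1 : ℝ) ≤ ∏ k ∈ s, (partialDistMax g (b k) : ℝ) := by
  exact_mod_cast Finset.one_le_prod' fun k (_ : k ∈ s) => one_le_partialDistMax g (b k)

/-- The bound on -log z is multiplied by D and increased by log 64 at each step. As D ≥ 1, each
increment is at most log 64 times the full product, hence the factor linear in `m`. -/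
theorem exp_le_bhatt_quatChannel (g : QuatKernel) (V : Channel Pair) (b : ℕ → Fin 4) {a : ℝ}
    (ha : 0 ≤ a) (hV : ∀ x x', x ≠ x' → Real.exp (-a) ≤ V.bhatt x x') (m : ℕ) :
    ∀ x x', x ≠ x' → Real.exp (-((a + m * Real.log 64) *
      ∏ k ∈ Finset.range m, (partialDistMax g (b k) : ℝ))) ≤
        (quatChannel g V b m).bhatt x x' := by
  have hl : 0 ≤ Real.log 64 := Real.log_nonneg (by norm_num)
  induction m with
  | zero =>
    intro x x' hx
    rw [Nat.cast_zero, zero_mul, add_zero, Finset.range_zero, Finset.prod_empty, mul_one]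
    exact hV x x' hx
  | succ m ih =>
    intro x x' _
    set Q := ∏ k ∈ Finset.range m, (partialDistMax g (b k) : ℝ) with hQ
    have hQ1 : 1 ≤ Q := one_le_prod_partialDistMax g b _
    have hd : (1 : ℝ) ≤ partialDistMax g (b m) := by exact_mod_cast one_le_partialDistMax g (b m)
    refine le_trans ?_ (le_bhatt_quatSplit g (quatChannel g V b m) (b m) (Real.exp_pos _).le
      (Real.exp_le_one_iff.2 ?_) ih x x')
    · rw [← Real.exp_nat_mul, div_eq_mul_inv, ← Real.exp_log (show (0 : ℝ) < 64⁻¹ by norm_num),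
        ← Real.exp_add, Real.exp_le_exp, Real.log_inv, Finset.prod_range_succ]
      push_cast
      have h := mul_le_mul_of_nonneg_left (one_le_mul_of_one_le_of_one_le hQ1 hd) hl
      have e : (a + (m + 1) * Real.log 64) * (Q * partialDistMax g (b m)) =
          partialDistMax g (b m) * ((a + m * Real.log 64) * Q) +
            Real.log 64 * (Q * partialDistMax g (b m)) := by ring
      rw [e]
      linarith only [h]
    · exact neg_nonpos.2 (mul_nonneg (add_nonneg ha (mul_nonneg (Nat.cast_nonneg _) hl))
        (zero_le_one.trans hQ1))

/-! ### The tree process along a path -/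

variable {g₁ : Bit → Pair → Bit → Word} {g₂ : QuatKernel} {W : Channel Bit}

theorem quatChannel_congr {g : QuatKernel} {V : Channel Pair} {b b' : ℕ → Fin 4} {n : ℕ}
    (h : ∀ k < n, b k = b' k) : quatChannel g V b n = quatChannel g V b' n := by
  induction n with
  | zero => rfl
  | succ n ih =>
    rw [quatChannel, quatChannel, ih fun k hk => h k (Nat.lt_succ_of_lt hk), h n (Nat.lt_succ_self n)]

theorem mixedChannel_congr {b₁ b₁' : ℕ → Fin 3} {b₂ b₂' : ℕ → Fin 4} {n : ℕ}
    (h₁ : ∀ k < n, b₁ k = b₁' k) (h₂ : ∀ k < n, b₂ k = b₂' k) :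
    mixedChannel g₁ g₂ W b₁ b₂ n = mixedChannel g₁ g₂ W b₁' b₂' n := by
  induction n with
  | zero => rfl
  | succ n ih =>
    rw [mixedChannel, mixedChannel, ih (fun k hk => h₁ k (Nat.lt_succ_of_lt hk))
      (fun k hk => h₂ k (Nat.lt_succ_of_lt hk)), h₁ n (Nat.lt_succ_self n),
      h₂ n (Nat.lt_succ_self n)]

theorem mixedChannel_add {b₁ : ℕ → Fin 3} {b₂ : ℕ → Fin 4} {t : ℕ} {V : Channel Pair}
    (h : mixedChannel g₁ g₂ W b₁ b₂ t = Sum.inr V) (m : ℕ) :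
    mixedChannel g₁ g₂ W b₁ b₂ (t + m) =
      Sum.inr (quatChannel g₂ V (fun k => b₂ (t + k)) m) := by
  induction m with
  | zero => exact h
  | succ m ih =>
    rw [← add_assoc, mixedChannel, ih]
    rfl

theorem exists_mixedChannel_eq_inr {b₁ : ℕ → Fin 3} {b₂ : ℕ → Fin 4} {t : ℕ} (h : b₁ t = 1) :
    ∃ V, mixedChannel g₁ g₂ W b₁ b₂ (t + 1) = Sum.inr V := by
  rw [mixedChannel, h]
  rcases mixedChannel g₁ g₂ W b₁ b₂ t with V | V
  · exact ⟨_, rfl⟩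
  · exact ⟨_, rfl⟩

/-- All Bhattacharyya parameters of the channel are positive. -/
def MixedChannel.BhattPos : MixedChannel → Prop
  | Sum.inl W => ∀ x x', 0 < W.bhatt x x'
  | Sum.inr W => ∀ x x', 0 < W.bhatt x x'

theorem bhattPos_mixedChannel (hW : W.Z ≠ 0) (b₁ : ℕ → Fin 3) (b₂ : ℕ → Fin 4) (n : ℕ) :
    (mixedChannel g₁ g₂ W b₁ b₂ n).BhattPos := by
  induction n with
  | zero => exact bhatt_pos_of_Z_ne_zero W hW
  | succ n ih =>
    rw [mixedChannel]
    generalize mixedChannel g₁ g₂ W b₁ b₂ n = M at ih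
    rcases M with V | V
    · simp only [mixedStep]
      split_ifs
      · exact fun x x' => V.bhatt_split_pos ih _ x x'
      · exact fun x x' => V.bhatt_split_pos ih _ x x'
      · exact fun x x' => V.bhatt_split_pos ih _ x x'
    · exact fun x x' => V.bhatt_split_pos ih _ x x'

/-- Mutual information divided by the number of input bits. -/
def MixedChannel.normInfo : MixedChannel → ℝ
  | Sum.inl W => W.info
  | Sum.inr W => W.info / 2

theorem MixedChannel.normInfo_nonneg : ∀ M : MixedChannel, 0 ≤ M.normInfo
  | Sum.inl V => info_nonneg V
  | Sum.inr V => div_nonneg (info_nonneg V) zero_le_two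

theorem MixedChannel.normInfo_le_one : ∀ M : MixedChannel, M.normInfo ≤ 1
  | Sum.inl V => info_bit_le V
  | Sum.inr V => info_pair_le V

/-- The law of a single choice of index for `g₁`. -/
def stepLaw : Fin 3 → ℝ := ![1 / 4, 1 / 2, 1 / 4]

/-- The weight 1/2 of the glued index offsets the division by two input bits; conservation of
information does the rest. -/
theorem sum_normInfo_mixedStep
    (hg : Function.Bijective fun z : Bit × Pair × Bit => g₁ z.1 z.2.1 z.2.2) (M : MixedChannel) :
    ∑ x : Fin 3 × Fin 4, stepLaw x.1 * (1 / 4) * (mixedStep g₁ g₂ x.1 x.2 M).normInfo =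
      M.normInfo := by
  rw [Fintype.sum_prod_type]
  rcases M with V | V
  · have h := info_binary hg V
    have e : ∀ (i : Fin 3) (c : ℝ), ∑ _j : Fin 4, stepLaw i * (1 / 4) * c = stepLaw i * c := by
      intro i c
      simp
      ring
    simp only [mixedStep, e, Fin.sum_univ_three]
    simp [stepLaw, MixedChannel.normInfo]
    linarith
  · have h := sum_info_quatSplit g₂ V
    simp only [mixedStep, MixedChannel.normInfo, ← Finset.mul_sum, ← Finset.sum_div, h,
      Fin.sum_univ_three]
    simp [stepLaw]
    ring

/-- Along a path on which the capacity tends to one, the Bhattacharyya parameter decays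
doubly exponentially. -/
theorem eventually_Z_le_of_normInfo_tendsto_one {b₁ : ℕ → Fin 3} {b₂ : ℕ → Fin 4} {t : ℕ} {V : Channel Pair}
    (hV : mixedChannel g₁ g₂ W b₁ b₂ t = Sum.inr V)
    (hI : Tendsto (fun n => (mixedChannel g₁ g₂ W b₁ b₂ n).normInfo) atTop (𝓝 1)) {E β : ℝ}
    (hS : Tendsto (fun n : ℕ => (∑ k ∈ Finset.range n,
      Real.logb 4 (partialDistMin g₂ (b₂ k))) / n) atTop (𝓝 E)) (hβ : β < E) :
    ∀ᶠ n : ℕ in atTop, (mixedChannel g₁ g₂ W b₁ b₂ n).Z ≤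
      (2 : ℝ) ^ (-((4 : ℝ) ^ (β * (n : ℝ)))) := by
  have hadd := mixedChannel_add hV
  have hZ0 : ∀ n, 0 ≤ (mixedChannel g₁ g₂ W b₁ b₂ n).Z := by
    intro n
    rcases mixedChannel g₁ g₂ W b₁ b₂ n with U | U
    · exact U.Z_nonneg
    · exact U.Z_nonneg
  have hI' : Tendsto (fun m => (quatChannel g₂ V (fun k => b₂ (t + k)) m).info / 2) atTop (𝓝 1) := by
    have := hI.comp (tendsto_add_atTop_nat t)
    refine this.congr fun m => ?_
    rw [Function.comp_apply, add_comm, hadd]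
    rfl
  have hZ : Tendsto (fun n => (mixedChannel g₁ g₂ W b₁ b₂ n).Z) atTop (𝓝 0) := by
    rw [← tendsto_add_atTop_iff_nat t]
    refine (tendsto_Z_of_info_tendsto_one hI').congr fun m => ?_
    rw [add_comm, hadd]
    rfl
  have hZ12 : Tendsto (fun n => 12 * (mixedChannel g₁ g₂ W b₁ b₂ n).Z) atTop (𝓝 0) := by
    simpa using hZ.const_mul 12
  -- The recursion is only needed eventually, so the averages may be taken from time 0 although `g₂`
  -- acts only from time `t` at the latest.
  have hrec : ∀ᶠ n in atTop, 12 * (mixedChannel g₁ g₂ W b₁ b₂ (n + 1)).Z ≤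
      768 * (12 * (mixedChannel g₁ g₂ W b₁ b₂ n).Z) ^ partialDistMin g₂ (b₂ n) := by
    filter_upwards [hZ12.eventually (gt_mem_nhds one_pos), eventually_ge_atTop t] with n hn htn
    obtain ⟨m, rfl⟩ := Nat.exists_eq_add_of_le htn
    rw [hadd] at hn
    rw [add_assoc, hadd, hadd]
    exact Z_quatSplit_le g₂ _ _ hn.le
  filter_upwards [eventually_le_of_le_mul_pow (fun n => mul_nonneg (by norm_num) (hZ0 n)) hZ12
    (fun n => one_le_partialDistMin g₂ (b₂ n)) (by norm_num) hrec hS hβ] with n hn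
  linarith [hZ0 n]

theorem eventually_half_lt_Z_of_normInfo_tendsto_zero {b₁ : ℕ → Fin 3} {b₂ : ℕ → Fin 4} {t : ℕ}
    {V : Channel Pair} (hV : mixedChannel g₁ g₂ W b₁ b₂ t = Sum.inr V)
    (hI : Tendsto (fun n => (mixedChannel g₁ g₂ W b₁ b₂ n).normInfo) atTop (𝓝 0)) :
    ∀ᶠ n : ℕ in atTop, 1 / 2 < (mixedChannel g₁ g₂ W b₁ b₂ n).Z := by
  have hadd := mixedChannel_add hV
  have hI' : Tendsto (fun m => (quatChannel g₂ V (fun k => b₂ (t + k)) m).info / 2) atTop (𝓝 0) := by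
    have := hI.comp (tendsto_add_atTop_nat t)
    refine this.congr fun m => ?_
    rw [Function.comp_apply, add_comm, hadd]
    rfl
  obtain ⟨N, hN⟩ := eventually_atTop.1 (eventually_half_lt_Z hI')
  refine eventually_atTop.2 ⟨t + N, fun n hn => ?_⟩
  obtain ⟨m, rfl⟩ := Nat.exists_eq_add_of_le ((Nat.le_add_right t N).trans hn)
  rw [hadd]
  exact hN m (by omega)

theorem eventually_le_Z {b₁ : ℕ → Fin 3} {b₂ : ℕ → Fin 4} {t : ℕ} {V : Channel Pair}
    (hV : mixedChannel g₁ g₂ W b₁ b₂ t = Sum.inr V) (hW : W.Z ≠ 0) {E β : ℝ}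
    (hS : Tendsto (fun n : ℕ => (∑ k ∈ Finset.range n,
      Real.logb 4 (partialDistMax g₂ (b₂ k))) / n) atTop (𝓝 E)) (hβ : E < β) :
    ∀ᶠ n : ℕ in atTop, (2 : ℝ) ^ (-((4 : ℝ) ^ (β * (n : ℝ)))) ≤
      (mixedChannel g₁ g₂ W b₁ b₂ n).Z := by
  have hadd := mixedChannel_add hV
  have hpos : ∀ x x', 0 < V.bhatt x x' := by
    have := bhattPos_mixedChannel (g₁ := g₁) (g₂ := g₂) hW b₁ b₂ t
    rwa [hV] at this
  -- A sum of nonnegative terms, so that exp(-a) lies below every parameter at once.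
  set a := ∑ p : Pair × Pair, -Real.log (V.bhatt p.1 p.2) with ha
  have hterm : ∀ p : Pair × Pair, 0 ≤ -Real.log (V.bhatt p.1 p.2) := fun p =>
    neg_nonneg.2 (Real.log_nonpos (V.bhatt_nonneg _ _) (V.bhatt_le_one _ _))
  have ha0 : 0 ≤ a := Finset.sum_nonneg fun p _ => hterm p
  have hexp : ∀ x x', x ≠ x' → Real.exp (-a) ≤ V.bhatt x x' := fun x x' _ => by
    rw [← Real.le_log_iff_exp_le (hpos x x'), neg_le]
    exact Finset.single_le_sum (f := fun p : Pair × Pair => -Real.log (V.bhatt p.1 p.2))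
      (fun p _ => hterm p) (Finset.mem_univ (x, x'))
  have hl : 0 ≤ Real.log 64 := Real.log_nonneg (by norm_num)
  refine eventually_ge_of_exp_mul_prod_le (fun n => one_le_partialDistMax g₂ (b₂ n)) ?_ hS hβ ha0 hl
  filter_upwards [eventually_ge_atTop t] with n hn
  obtain ⟨m, rfl⟩ := Nat.exists_eq_add_of_le hn
  rw [hadd]
  refine Channel.le_Z _ fun x x' hx =>
    le_trans ?_ (exp_le_bhatt_quatChannel g₂ V (fun k => b₂ (t + k)) ha0 hexp m x x' hx)
  -- The first `t` factors are at least 1, so including them only weakens the bound.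
  rw [Real.exp_le_exp, neg_le_neg_iff, Finset.prod_range_add]
  have h2 : (0 : ℝ) ≤ ∏ k ∈ Finset.range m, (partialDistMax g₂ (b₂ (t + k)) : ℝ) :=
    Finset.prod_nonneg fun _ _ => Nat.cast_nonneg _
  refine mul_le_mul ?_ (le_mul_of_one_le_left h2 (one_le_prod_partialDistMax g₂ b₂ _)) h2 (by positivity)
  push_cast
  nlinarith [Nat.cast_nonneg (α := ℝ) t]

/-! ### The probability space -/

section Probability

variable {Ω : Type*} [mΩ : MeasurableSpace Ω] {P : Measure Ω} [IsProbabilityMeasure P]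

theorem ae_tendsto_average {k : ℕ} {B : ℕ → Ω → Fin k} (hB : ∀ n, Measurable (B n))
    (hind : iIndepFun B P) {w : Fin k → ℝ} (hw : ∀ n i, P.real {ω | B n ω = i} = w i)
    (f : Fin k → ℝ) :
    ∀ᵐ ω ∂P, Tendsto (fun n : ℕ => (∑ i ∈ Finset.range n, f (B i ω)) / n) atTop
      (𝓝 (∑ i, w i * f i)) := by
  have hf : Measurable f := measurable_of_finite f
  have hident : ∀ i, IdentDistrib (B i) (B 0) P P := fun i =>
    ⟨(hB i).aemeasurable, (hB 0).aemeasurable, by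
      refine Measure.ext_of_singleton fun a => ?_
      rw [Measure.map_apply (hB i) (measurableSet_singleton a),
        Measure.map_apply (hB 0) (measurableSet_singleton a), ← measureReal_eq_measureReal_iff]
      exact (hw i a).trans (hw 0 a).symm⟩
  have hint : Integrable (fun ω => f (B 0 ω)) P :=
    Integrable.of_finite.comp_measurable (hB 0)
  have h := strong_law_ae_real (μ := P) (fun n ω => f (B n ω)) hint
    (fun i j hij => (hind.indepFun hij).comp hf hf) fun i => (hident i).comp hf
  have hE : ∫ ω, f (B 0 ω) ∂P = ∑ i, w i * f i := by
    have hprob : IsProbabilityMeasure (P.map (B 0)) :=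
      Measure.isProbabilityMeasure_map (hB 0).aemeasurable
    rw [← integral_map (hB 0).aemeasurable hf.aestronglyMeasurable, integral_fintype Integrable.of_finite]
    refine Finset.sum_congr rfl fun i _ => ?_
    rw [map_measureReal_apply (hB 0) (measurableSet_singleton i), smul_eq_mul]
    congr 1
    exact hw 0 i
  rw [hE] at h
  exact h

omit [IsProbabilityMeasure P] in
theorem measureReal_path_eq {k : ℕ} {B : ℕ → Ω → Fin k}
    (hind : iIndepFun B P) {w : Fin k → ℝ} (hw : ∀ n i, P.real {ω | B n ω = i} = w i)
    (t n : ℕ) (s : Fin n → Fin k) :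
    P.real {ω | ∀ j : Fin n, B (t + j) ω = s j} = ∏ j, w (s j) := by
  have hinj : Function.Injective fun j : Fin n => t + (j : ℕ) := fun i j h => by
    have : t + (i : ℕ) = t + (j : ℕ) := h
    exact Fin.ext (by omega)
  have h := (hind.precomp hinj).measure_inter_preimage_eq_mul (S := Finset.univ)
    (sets := fun j => {s j}) fun j _ => measurableSet_singleton _
  have e : {ω | ∀ j : Fin n, B (t + j) ω = s j} =
      ⋂ j ∈ (Finset.univ : Finset (Fin n)), (fun ω => B (t + (j : ℕ)) ω) ⁻¹' {s j} := by
    ext ω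
    simp
  rw [e, measureReal_def, h, ENNReal.toReal_prod]
  exact Finset.prod_congr rfl fun j _ => hw (t + j) (s j)

variable {B₁ : ℕ → Ω → Fin 3} {B₂ : ℕ → Ω → Fin 4}

omit [IsProbabilityMeasure P] in
theorem IsDriving.law₁ (hB : IsDriving P B₁ B₂) (n : ℕ) (i : Fin 3) :
    P.real {ω | B₁ n ω = i} = stepLaw i := by
  fin_cases i
  · exact hB.law₁_zero n
  · exact hB.law₁_one n
  · exact hB.law₁_two n

/-- The first `n` choices of both sequences. -/
def path (B₁ : ℕ → Ω → Fin 3) (B₂ : ℕ → Ω → Fin 4) (n : ℕ) (ω : Ω) : Fin n → Fin 3 × Fin 4 :=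
  fun j => (B₁ j ω, B₂ j ω)

omit [IsProbabilityMeasure P] in
theorem measurable_path (hB : IsDriving P B₁ B₂) (n : ℕ) : Measurable (path B₁ B₂ n) :=
  measurable_pi_lambda _ fun j => (hB.measurable₁ j).prodMk (hB.measurable₂ j)

omit [IsProbabilityMeasure P] in
theorem measureReal_path (hB : IsDriving P B₁ B₂) (n : ℕ) (s : Fin n → Fin 3 × Fin 4) :
    P.real {ω | path B₁ B₂ n ω = s} = ∏ j, stepLaw (s j).1 * (1 / 4) := by
  have h1 := measureReal_path_eq hB.indep₁ hB.law₁ 0 n fun j => (s j).1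
  have h2 := measureReal_path_eq hB.indep₂ hB.law₂ 0 n fun j => (s j).2
  simp only [zero_add] at h1 h2
  have hm1 : MeasurableSet {b : ℕ → Fin 3 | ∀ j : Fin n, b j = (s j).1} := by
    rw [Set.ofPred_forall]
    exact MeasurableSet.iInter fun j => measurable_pi_apply _ (measurableSet_singleton _)
  have hm2 : MeasurableSet {b : ℕ → Fin 4 | ∀ j : Fin n, b j = (s j).2} := by
    rw [Set.ofPred_forall]
    exact MeasurableSet.iInter fun j => measurable_pi_apply _ (measurableSet_singleton _)
  have h := hB.indep.measure_inter_preimage_eq_mul _ _ hm1 hm2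
  have e : {ω | path B₁ B₂ n ω = s} =
      (fun ω n => B₁ n ω) ⁻¹' {b : ℕ → Fin 3 | ∀ j : Fin n, b j = (s j).1} ∩
      (fun ω n => B₂ n ω) ⁻¹' {b : ℕ → Fin 4 | ∀ j : Fin n, b j = (s j).2} := by
    ext ω
    simp only [path, funext_iff, Prod.ext_iff, Set.mem_ofPred_eq, Set.mem_inter_iff,
      Set.mem_preimage, forall_and]
  rw [e, measureReal_def, h, ENNReal.toReal_mul, Finset.prod_mul_distrib, ← h1, ← h2]
  rfl

theorem integral_path (hB : IsDriving P B₁ B₂) (n : ℕ) (φ : (Fin n → Fin 3 × Fin 4) → ℝ) :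
    ∫ ω, φ (path B₁ B₂ n ω) ∂P = ∑ s, (∏ j, stepLaw (s j).1 * (1 / 4)) * φ s := by
  have hp := measurable_path hB n
  have hprob : IsProbabilityMeasure (P.map (path B₁ B₂ n)) :=
    Measure.isProbabilityMeasure_map hp.aemeasurable
  rw [← integral_map hp.aemeasurable (measurable_of_finite φ).aestronglyMeasurable,
    integral_fintype Integrable.of_finite]
  refine Finset.sum_congr rfl fun s _ => ?_
  rw [map_measureReal_apply hp (measurableSet_singleton s), smul_eq_mul, ← measureReal_path hB]
  rfl

/-- The channel reached along a finite sequence of choices. -/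
def pathChannel (g₁ : Bit → Pair → Bit → Word) (g₂ : QuatKernel) (W : Channel Bit) (n : ℕ)
    (s : Fin n → Fin 3 × Fin 4) : MixedChannel :=
  -- The default 0 is never read: the channel at time `n` depends only on the first `n` choices.
  mixedChannel g₁ g₂ W (fun k => if h : k < n then (s ⟨k, h⟩).1 else 0)
    (fun k => if h : k < n then (s ⟨k, h⟩).2 else 0) n

omit mΩ in
theorem pathChannel_path (n : ℕ) (ω : Ω) :
    pathChannel g₁ g₂ W n (path B₁ B₂ n ω) =
      mixedChannel g₁ g₂ W (fun k => B₁ k ω) (fun k => B₂ k ω) n :=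
  mixedChannel_congr (fun k hk => by simp [hk, path]) (fun k hk => by simp [hk, path])

theorem pathChannel_snoc (n : ℕ) (s : Fin n → Fin 3 × Fin 4) (x : Fin 3 × Fin 4) :
    pathChannel g₁ g₂ W (n + 1) (Fin.snoc s x : Fin (n + 1) → Fin 3 × Fin 4) =
      mixedStep g₁ g₂ x.1 x.2 (pathChannel g₁ g₂ W n s) := by
  have hlast : ∀ h : n < n + 1, (Fin.snoc s x : Fin (n + 1) → Fin 3 × Fin 4) ⟨n, h⟩ = x :=
    fun h => Fin.snoc_last (α := fun _ => Fin 3 × Fin 4) x s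
  have hlt : ∀ (k : ℕ) (hk : k < n) (h : k < n + 1),
      (Fin.snoc s x : Fin (n + 1) → Fin 3 × Fin 4) ⟨k, h⟩ = s ⟨k, hk⟩ := fun k hk h =>
    Fin.snoc_castSucc (α := fun _ => Fin 3 × Fin 4) x s ⟨k, hk⟩
  rw [pathChannel, mixedChannel, dif_pos (Nat.lt_succ_self n), dif_pos (Nat.lt_succ_self n), hlast]
  congr 1
  refine mixedChannel_congr (fun k hk => ?_) (fun k hk => ?_)
  · rw [dif_pos hk, dif_pos (Nat.lt_succ_of_lt hk), hlt k hk]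
  · rw [dif_pos hk, dif_pos (Nat.lt_succ_of_lt hk), hlt k hk]

/-- The normalized mutual information of the tree process. -/
def infoProc (g₁ : Bit → Pair → Bit → Word) (g₂ : QuatKernel) (W : Channel Bit)
    (B₁ : ℕ → Ω → Fin 3) (B₂ : ℕ → Ω → Fin 4) (n : ℕ) (ω : Ω) : ℝ :=
  (mixedChannel g₁ g₂ W (fun k => B₁ k ω) (fun k => B₂ k ω) n).normInfo

omit mΩ in
-- Factoring through the finite-valued path gives measurability and reduces integrals to finite
-- sums.
theorem infoProc_eq (n : ℕ) : infoProc g₁ g₂ W B₁ B₂ n =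
    fun ω => (pathChannel g₁ g₂ W n (path B₁ B₂ n ω)).normInfo := by
  funext ω
  rw [pathChannel_path, infoProc]

omit mΩ in
theorem Zproc_eq (n : ℕ) : Zproc g₁ g₂ W B₁ B₂ n =
    fun ω => (pathChannel g₁ g₂ W n (path B₁ B₂ n ω)).Z := by
  funext ω
  rw [pathChannel_path, Zproc]

omit mΩ in
theorem infoProc_nonneg (n : ℕ) (ω : Ω) : 0 ≤ infoProc g₁ g₂ W B₁ B₂ n ω :=
  MixedChannel.normInfo_nonneg _

omit mΩ in
theorem infoProc_le_one (n : ℕ) (ω : Ω) : infoProc g₁ g₂ W B₁ B₂ n ω ≤ 1 :=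
  MixedChannel.normInfo_le_one _

omit [IsProbabilityMeasure P] in
theorem measurable_infoProc (hB : IsDriving P B₁ B₂) (n : ℕ) :
    Measurable (infoProc g₁ g₂ W B₁ B₂ n) := by
  rw [infoProc_eq]
  exact (measurable_of_finite fun s => (pathChannel g₁ g₂ W n s).normInfo).comp
    (measurable_path hB n)

omit [IsProbabilityMeasure P] in
theorem measurable_Zproc (hB : IsDriving P B₁ B₂) (n : ℕ) :
    Measurable (Zproc g₁ g₂ W B₁ B₂ n) := by
  rw [Zproc_eq]
  exact (measurable_of_finite fun s => (pathChannel g₁ g₂ W n s).Z).comp (measurable_path hB n)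

omit mΩ in
theorem norm_infoProc_le (n : ℕ) (ω : Ω) : ‖infoProc g₁ g₂ W B₁ B₂ n ω‖ ≤ 1 := by
  rw [Real.norm_of_nonneg (infoProc_nonneg n ω)]
  exact infoProc_le_one n ω

theorem integrable_infoProc (hB : IsDriving P B₁ B₂) (n : ℕ) :
    Integrable (infoProc g₁ g₂ W B₁ B₂ n) P :=
  Integrable.of_bound (measurable_infoProc hB n).aestronglyMeasurable 1
    (Eventually.of_forall (norm_infoProc_le n))

/-- The martingale identity: the path law is a product, and summing over the last choice is
`sum_normInfo_mixedStep`. -/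
theorem setIntegral_infoProc_succ (hB : IsDriving P B₁ B₂)
    (hg : Function.Bijective fun z : Bit × Pair × Bit => g₁ z.1 z.2.1 z.2.2) (n : ℕ)
    (S : Set (Fin n → Fin 3 × Fin 4)) :
    ∫ ω in path B₁ B₂ n ⁻¹' S, infoProc g₁ g₂ W B₁ B₂ n ω ∂P =
      ∫ ω in path B₁ B₂ n ⁻¹' S, infoProc g₁ g₂ W B₁ B₂ (n + 1) ω ∂P := by
  classical
  have hS : MeasurableSet (path B₁ B₂ n ⁻¹' S) := measurable_path hB n (Set.toFinite S).measurableSet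
  rw [← integral_indicator hS, ← integral_indicator hS]
  have e1 : (path B₁ B₂ n ⁻¹' S).indicator (infoProc g₁ g₂ W B₁ B₂ n) = fun ω =>
      (fun s => if s ∈ S then (pathChannel g₁ g₂ W n s).normInfo else 0) (path B₁ B₂ n ω) := by
    funext ω
    rw [infoProc_eq]
    rfl
  have e2 : (path B₁ B₂ n ⁻¹' S).indicator (infoProc g₁ g₂ W B₁ B₂ (n + 1)) = fun ω =>
      (fun s : Fin (n + 1) → Fin 3 × Fin 4 => if (fun j : Fin n => s j.castSucc) ∈ S then
        (pathChannel g₁ g₂ W (n + 1) s).normInfo else 0) (path B₁ B₂ (n + 1) ω) := by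
    funext ω
    rw [infoProc_eq]
    rfl
  rw [e1, e2, integral_path hB n fun s => if s ∈ S then (pathChannel g₁ g₂ W n s).normInfo else 0,
    integral_path hB (n + 1) fun s => if (fun j : Fin n => s j.castSucc) ∈ S then
        (pathChannel g₁ g₂ W (n + 1) s).normInfo else 0,
    ← (Fin.snocEquiv fun _ => Fin 3 × Fin 4).sum_comp, Fintype.sum_prod_type, Finset.sum_comm]
  refine Finset.sum_congr rfl fun s _ => ?_
  have hsnoc : ∀ x, (Fin.snocEquiv fun _ => Fin 3 × Fin 4) (x, s) =
      (Fin.snoc s x : Fin (n + 1) → Fin 3 × Fin 4) := fun x => rfl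
  simp only [hsnoc, Fin.prod_univ_castSucc, Fin.snoc_castSucc, Fin.snoc_last, pathChannel_snoc]
  split_ifs with h
  · rw [← sum_normInfo_mixedStep hg (pathChannel g₁ g₂ W n s), Finset.mul_sum]
    exact Finset.sum_congr rfl fun x _ => by ring
  · simp

theorem integral_infoProc (hB : IsDriving P B₁ B₂)
    (hg : Function.Bijective fun z : Bit × Pair × Bit => g₁ z.1 z.2.1 z.2.2) (n : ℕ) :
    ∫ ω, infoProc g₁ g₂ W B₁ B₂ n ω ∂P = W.info := by
  induction n with
  | zero =>
    have : infoProc g₁ g₂ W B₁ B₂ 0 = fun _ => W.info := rfl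
    rw [this]
    simp
  | succ n ih =>
    have := setIntegral_infoProc_succ (W := W) (g₂ := g₂) hB hg n Set.univ
    rw [Set.preimage_univ, setIntegral_univ, setIntegral_univ] at this
    rw [← this, ih]

/-- The filtration generated by the choices. -/
def pathFiltration (hB : IsDriving P B₁ B₂) : Filtration ℕ mΩ where
  seq n := MeasurableSpace.comap (path B₁ B₂ n) inferInstance
  mono' i j hij := by
    have hr : Measurable fun (s : Fin j → Fin 3 × Fin 4) (k : Fin i) => s (Fin.castLE hij k) :=
      measurable_of_finite _
    have e : path B₁ B₂ i = (fun (s : Fin j → Fin 3 × Fin 4) (k : Fin i) => s (Fin.castLE hij k)) ∘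
        path B₁ B₂ j := rfl
    change MeasurableSpace.comap (path B₁ B₂ i) _ ≤ MeasurableSpace.comap (path B₁ B₂ j) _
    rw [e, ← MeasurableSpace.comap_comp]
    exact MeasurableSpace.comap_mono hr.comap_le
  le' n := (measurable_path hB n).comap_le

theorem martingale_infoProc (hB : IsDriving P B₁ B₂)
    (hg : Function.Bijective fun z : Bit × Pair × Bit => g₁ z.1 z.2.1 z.2.2) :
    Martingale (infoProc g₁ g₂ W B₁ B₂) (pathFiltration hB) P := by
  refine martingale_of_setIntegral_eq_succ (fun n => ?_) (integrable_infoProc hB) ?_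
  · refine Measurable.stronglyMeasurable ?_
    rw [infoProc_eq]
    exact (measurable_of_finite fun s => (pathChannel g₁ g₂ W n s).normInfo).comp
      (comap_measurable (path B₁ B₂ n))
  · rintro n _ ⟨S, -, rfl⟩
    exact setIntegral_infoProc_succ hB hg n S

theorem ae_exists_tendsto_infoProc (hB : IsDriving P B₁ B₂)
    (hg : Function.Bijective fun z : Bit × Pair × Bit => g₁ z.1 z.2.1 z.2.2) :
    ∀ᵐ ω ∂P, ∃ c, Tendsto (fun n => infoProc g₁ g₂ W B₁ B₂ n ω) atTop (𝓝 c) := by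
  refine (martingale_infoProc hB hg).submartingale.exists_ae_tendsto_of_bdd (R := 1) fun n => ?_
  refine (eLpNorm_le_of_ae_bound (C := 1) (Eventually.of_forall (norm_infoProc_le n))).trans ?_
  simp

/-- The law of polarization along shifted choices. -/
theorem measureReal_quatChannel_info (hB : IsDriving P B₁ B₂) (V : Channel Pair) (t n : ℕ)
    (S : Set ℝ) :
    P.real {ω | (quatChannel g₂ V (fun k => B₂ (t + k) ω) n).info / 2 ∈ S} =
      (Nat.card {b : Fin n → Fin 4 //
        (quatChannel g₂ V (fun k => if h : k < n then b ⟨k, h⟩ else 0) n).info / 2 ∈ S} : ℝ) /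
        4 ^ n := by
  classical
  let Q : (Fin n → Fin 4) → Prop := fun b =>
    (quatChannel g₂ V (fun k => if h : k < n then b ⟨k, h⟩ else 0) n).info / 2 ∈ S
  let X : Ω → Fin n → Fin 4 := fun ω j => B₂ (t + j) ω
  have hX : Measurable X := measurable_pi_lambda _ fun j => hB.measurable₂ _
  have e : {ω | (quatChannel g₂ V (fun k => B₂ (t + k) ω) n).info / 2 ∈ S} =
      ⋃ b ∈ Finset.univ.filter Q, X ⁻¹' {b} := by
    ext ω
    have hc : quatChannel g₂ V (fun k => B₂ (t + k) ω) n =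
        quatChannel g₂ V (fun k => if h : k < n then X ω ⟨k, h⟩ else 0) n :=
      quatChannel_congr fun k hk => by simp [hk, X]
    simp only [Set.mem_ofPred_eq, hc]
    simp [Q]
  have hlaw : ∀ b, P.real (X ⁻¹' {b}) = (1 / 4) ^ n := by
    intro b
    have := measureReal_path_eq hB.indep₂ hB.law₂ t n b
    rw [Finset.prod_const, Finset.card_univ, Fintype.card_fin] at this
    rw [← this]
    congr 1
    ext ω
    simp [X, funext_iff]
  rw [e, measureReal_biUnion_finset]
  · simp only [hlaw, Finset.sum_const, nsmul_eq_mul]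
    rw [Nat.card_eq_fintype_card, Fintype.card_subtype, one_div, inv_pow, div_eq_mul_inv]
  · intro b _ b' _ hbb
    exact Disjoint.preimage _ (by simpa using hbb)
  · exact fun b _ => hX (measurableSet_singleton b)

/-- A limit strictly between 0 and 1 would keep the sequence eventually inside some interval (δ,
1-δ). Staying there from time `N` on is no more likely than being there at any single n ≥ N, a
probability that tends to 0. The values δ = 1/(m+3) are countably many, below 1/2, and tend to 0. -/
theorem ae_limit_info_quatChannel (hB : IsDriving P B₁ B₂) (hg₂ : IsPolarizing g₂)
    (V : Channel Pair) (t : ℕ) :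
    ∀ᵐ ω ∂P, ∀ c, Tendsto (fun n => (quatChannel g₂ V (fun k => B₂ (t + k) ω) n).info / 2) atTop
      (𝓝 c) → c = 0 ∨ c = 1 := by
  have key : ∀ m : ℕ, ∀ᵐ ω ∂P, ¬ ∀ᶠ n in atTop,
      (quatChannel g₂ V (fun k => B₂ (t + k) ω) n).info / 2 ∈
        Set.Ioo (1 / ((m : ℝ) + 3)) (1 - 1 / ((m : ℝ) + 3)) := by
    intro m
    have hδ : (1 : ℝ) / (m + 3) < 1 / 2 :=
      one_div_lt_one_div_of_lt (by norm_num) (by linarith [Nat.cast_nonneg (α := ℝ) m])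
    have hlim := hg₂ V (1 / ((m : ℝ) + 3)) (by positivity) hδ
    simp only [← measureReal_quatChannel_info (P := P) hB V t] at hlim
    have hN : ∀ N : ℕ, P.real {ω | ∀ n, N ≤ n →
        (quatChannel g₂ V (fun k => B₂ (t + k) ω) n).info / 2 ∈
          Set.Ioo (1 / ((m : ℝ) + 3)) (1 - 1 / ((m : ℝ) + 3))} = 0 := by
      intro N
      refine le_antisymm (ge_of_tendsto hlim ?_) measureReal_nonneg
      filter_upwards [eventually_ge_atTop N] with n hn
      exact measureReal_mono fun ω hω => hω n hn
    rw [ae_iff]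
    simp only [not_not, eventually_atTop, Set.ofPred_exists, measure_iUnion_null_iff]
    intro N
    exact (measureReal_eq_zero_iff).1 (hN N)
  filter_upwards [ae_all_iff.2 key] with ω hω c hc
  have h0 : 0 ≤ c := ge_of_tendsto' hc fun n => div_nonneg (info_nonneg _) zero_le_two
  have h1 : c ≤ 1 := le_of_tendsto' hc fun n => info_pair_le _
  by_contra hne
  push Not at hne
  have h0' := h0.lt_of_ne' hne.1
  have h1' := sub_pos.2 (h1.lt_of_ne hne.2)
  obtain ⟨m, hm⟩ := exists_nat_one_div_lt (lt_min h0' h1')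
  have hm' : 1 / ((m : ℝ) + 3) < min c (1 - c) :=
    (one_div_le_one_div_of_le (by positivity) (by linarith)).trans_lt hm
  rw [lt_min_iff] at hm'
  exact hω m (hc.eventually (Ioo_mem_nhds hm'.1 (by linarith)))

/-- Almost surely the process eventually has quaternary inputs. -/
theorem ae_exists_mixedChannel_eq_inr (hB : IsDriving P B₁ B₂) :
    ∀ᵐ ω ∂P, ∃ t V, mixedChannel g₁ g₂ W (fun k => B₁ k ω) (fun k => B₂ k ω) t = Sum.inr V := by
  -- The frequency of the glued index tends to 1/2, so it must occur.
  filter_upwards [ae_tendsto_average hB.measurable₁ hB.indep₁ hB.law₁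
    fun i => if i = 1 then 1 else 0] with ω hω
  by_contra hne
  push Not at hne
  have h1 : ∀ t, B₁ t ω ≠ 1 := fun t ht => by
    obtain ⟨V, hV⟩ := exists_mixedChannel_eq_inr (g₁ := g₁) (g₂ := g₂) (W := W)
      (b₁ := fun k => B₁ k ω) (b₂ := fun k => B₂ k ω) ht
    exact hne _ V hV
  simp only [h1, if_false, Finset.sum_const_zero, zero_div] at hω
  have := tendsto_nhds_unique hω tendsto_const_nhds
  simp [stepLaw] at this

theorem ae_tendsto_average_quat (hB : IsDriving P B₁ B₂) (f : Fin 4 → ℝ) :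
    ∀ᵐ ω ∂P, Tendsto (fun n : ℕ => (∑ k ∈ Finset.range n, f (B₂ k ω)) / n) atTop
      (𝓝 ((1 / 4) * ∑ i, f i)) := by
  rw [Finset.mul_sum]
  exact ae_tendsto_average hB.measurable₂ hB.indep₂ hB.law₂ f

/-- Almost surely the normalized mutual information tends to zero or to one. -/
theorem ae_tendsto_infoProc_zero_or_one (hB : IsDriving P B₁ B₂) (hg₂ : IsPolarizing g₂)
    (hg : Function.Bijective fun z : Bit × Pair × Bit => g₁ z.1 z.2.1 z.2.2) :
    ∀ᵐ ω ∂P, Tendsto (fun n => infoProc g₁ g₂ W B₁ B₂ n ω) atTop (𝓝 0) ∨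
      Tendsto (fun n => infoProc g₁ g₂ W B₁ B₂ n ω) atTop (𝓝 1) := by
  -- The channel where the quaternary phase starts is random, but it is determined by `t` and one of
  -- finitely many paths, so countably many null sets suffice.
  have hall : ∀ᵐ ω ∂P, ∀ (t : ℕ) (s : Fin t → Fin 3 × Fin 4) (V : Channel Pair),
      pathChannel g₁ g₂ W t s = Sum.inr V → ∀ c,
      Tendsto (fun n => (quatChannel g₂ V (fun k => B₂ (t + k) ω) n).info / 2) atTop
        (𝓝 c) → c = 0 ∨ c = 1 := by
    refine ae_all_iff.2 fun t => ae_all_iff.2 fun s => ?_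
    rcases hM : pathChannel g₁ g₂ W t s with U | U
    · exact Eventually.of_forall fun ω V hV => by cases hV
    · filter_upwards [ae_limit_info_quatChannel hB hg₂ U t] with ω hω V hV
      cases hV
      exact hω
  filter_upwards [hall, ae_exists_tendsto_infoProc (W := W) (g₂ := g₂) hB hg,
    ae_exists_mixedChannel_eq_inr (g₁ := g₁) (g₂ := g₂) (W := W) hB] with ω h1 ⟨c, hc⟩ ⟨t, V, hV⟩
  have hlim : Tendsto (fun n => (quatChannel g₂ V (fun k => B₂ (t + k) ω) n).info / 2) atTop
      (𝓝 c) := by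
    refine (hc.comp (tendsto_add_atTop_nat t)).congr fun m => ?_
    rw [Function.comp_apply, infoProc, add_comm, mixedChannel_add hV]
    rfl
  rcases h1 t (path B₁ B₂ t ω) V ((pathChannel_path t ω).trans hV) c hlim with rfl | rfl
  · exact Or.inl hc
  · exact Or.inr hc

/-- Indicator and normalized information have the same almost sure limit, 0 or 1; integrating their
difference compares the probability with the constant mean. -/
theorem tendsto_measureReal_Zproc_le (hB : IsDriving P B₁ B₂) (hg₂ : IsPolarizing g₂)
    (hg : Function.Bijective fun z : Bit × Pair × Bit => g₁ z.1 z.2.1 z.2.2) {β : ℝ}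
    (hβ0 : 0 ≤ β) (hβ : β < E₁ g₂) :
    Tendsto (fun n : ℕ => P.real {ω | Zproc g₁ g₂ W B₁ B₂ n ω
      ≤ (2 : ℝ) ^ (-((4 : ℝ) ^ (β * (n : ℝ))))}) atTop (𝓝 W.info) := by
  set A : ℕ → Set Ω := fun n => {ω | Zproc g₁ g₂ W B₁ B₂ n ω
    ≤ (2 : ℝ) ^ (-((4 : ℝ) ^ (β * (n : ℝ))))} with hA
  have hAm : ∀ n, MeasurableSet (A n) := fun n =>
    measurableSet_le (measurable_Zproc hB n) measurable_const
  have hind : ∀ n, Integrable ((A n).indicator (1 : Ω → ℝ)) P := fun n =>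
    (integrable_const (1 : ℝ)).indicator (hAm n)
  have hae : ∀ᵐ ω ∂P, Tendsto (fun n => (A n).indicator (1 : Ω → ℝ) ω -
      infoProc g₁ g₂ W B₁ B₂ n ω) atTop (𝓝 0) := by
    filter_upwards [ae_tendsto_infoProc_zero_or_one (W := W) hB hg₂ hg,
      ae_exists_mixedChannel_eq_inr (g₁ := g₁) (g₂ := g₂) (W := W) hB,
      ae_tendsto_average_quat hB fun i => Real.logb 4 (partialDistMin g₂ i)] with
      ω hlim ⟨t, V, hV⟩ hS
    rcases hlim with h | h
    · have hev : ∀ᶠ n in atTop, (A n).indicator (1 : Ω → ℝ) ω = 0 := by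
        filter_upwards [eventually_half_lt_Z_of_normInfo_tendsto_zero hV h] with n hn
        refine Set.indicator_of_notMem (fun hmem => ?_) _
        -- Here β ≥ 0 matters: the threshold stays at most 1/2, below Z.
        have h4 : (1 : ℝ) ≤ (4 : ℝ) ^ (β * (n : ℝ)) :=
          Real.one_le_rpow (by norm_num) (by positivity)
        have h2 : (2 : ℝ) ^ (-((4 : ℝ) ^ (β * (n : ℝ)))) ≤ (2 : ℝ) ^ (-1 : ℝ) :=
          Real.rpow_le_rpow_of_exponent_le (by norm_num) (by linarith)
        rw [Real.rpow_neg_one] at h2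
        have h3 : Zproc g₁ g₂ W B₁ B₂ n ω ≤ 2⁻¹ := le_trans hmem h2
        rw [Zproc] at h3
        linarith
      simpa using (tendsto_const_nhds.congr' (hev.mono fun n hn => hn.symm)).sub h
    · have hev : ∀ᶠ n in atTop, (A n).indicator (1 : Ω → ℝ) ω = 1 := by
        filter_upwards [eventually_Z_le_of_normInfo_tendsto_one hV h hS hβ] with n hn
        exact Set.indicator_of_mem (show ω ∈ A n from hn) _
      simpa using (tendsto_const_nhds.congr' (hev.mono fun n hn => hn.symm)).sub h
  have hdom := tendsto_integral_of_dominated_convergence (μ := P) (fun _ => (2 : ℝ))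
    (F := fun n ω => (A n).indicator (1 : Ω → ℝ) ω - infoProc g₁ g₂ W B₁ B₂ n ω) (f := fun _ => 0)
    (fun n => ((hind n).sub (integrable_infoProc hB n)).aestronglyMeasurable)
    (integrable_const _) (fun n => Eventually.of_forall fun ω => by
      have h1 : ‖(A n).indicator (1 : Ω → ℝ) ω‖ ≤ 1 :=
        (norm_indicator_le_norm_self _ _).trans (by simp)
      have h2 := norm_infoProc_le (g₁ := g₁) (g₂ := g₂) (W := W) (B₁ := B₁) (B₂ := B₂) n ω
      linarith [norm_sub_le ((A n).indicator (1 : Ω → ℝ) ω) (infoProc g₁ g₂ W B₁ B₂ n ω)]) hae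
  have hint : ∀ n, ∫ ω, (A n).indicator (1 : Ω → ℝ) ω - infoProc g₁ g₂ W B₁ B₂ n ω ∂P =
      P.real (A n) - W.info := fun n => by
    rw [integral_sub (hind n) (integrable_infoProc hB n), integral_indicator_one (hAm n),
      integral_infoProc hB hg]
  simp only [hint, integral_zero] at hdom
  simpa using hdom.add_const W.info

theorem tendsto_measureReal_le_Zproc (hB : IsDriving P B₁ B₂) (hW : W.Z ≠ 0) {β : ℝ}
    (hβ : E₂ g₂ < β) :
    Tendsto (fun n : ℕ => P.real {ω | (2 : ℝ) ^ (-((4 : ℝ) ^ (β * (n : ℝ))))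
      ≤ Zproc g₁ g₂ W B₁ B₂ n ω}) atTop (𝓝 1) := by
  have hae : ∀ᵐ ω ∂P, ∀ᶠ n : ℕ in atTop, ω ∈ {ω | (2 : ℝ) ^ (-((4 : ℝ) ^ (β * (n : ℝ))))
      ≤ Zproc g₁ g₂ W B₁ B₂ n ω} ↔ ω ∈ Set.univ := by
    filter_upwards [ae_exists_mixedChannel_eq_inr (g₁ := g₁) (g₂ := g₂) (W := W) hB,
      ae_tendsto_average_quat hB fun i => Real.logb 4 (partialDistMax g₂ i)] with ω ⟨t, V, hV⟩ hS
    filter_upwards [eventually_le_Z hV hW hS hβ] with n hn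
    exact iff_of_true hn (Set.mem_univ ω)
  have h := tendsto_measure_of_ae_tendsto_indicator_of_isFiniteMeasure (μ := P) atTop
    MeasurableSet.univ
    (fun n => measurableSet_le measurable_const (measurable_Zproc (W := W) (g₁ := g₁) (g₂ := g₂) hB n)) hae
  rw [measure_univ] at h
  exact (ENNReal.tendsto_toReal ENNReal.one_ne_top).comp h

end Probability

end MixedKernel

end

theorem proposition4
    (T : MixedKernel.CodeDecomposition)
    (g₁ : MixedKernel.Bit → MixedKernel.Pair → MixedKernel.Bit → MixedKernel.Word)
    (hg₁ : T.Induces g₁)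
    (g₂ : MixedKernel.QuatKernel) (hg₂ : MixedKernel.IsPolarizing g₂)
    (W : MixedKernel.Channel MixedKernel.Bit) (hW : W.Z ≠ 0)
    {Ω : Type*} [MeasurableSpace Ω] (P : Measure Ω) [IsProbabilityMeasure P]
    (B₁ : ℕ → Ω → Fin 3) (B₂ : ℕ → Ω → Fin 4) (hB : MixedKernel.IsDriving P B₁ B₂) :
    (∀ β : ℝ, 0 ≤ β → β < MixedKernel.E₁ g₂ →
      Tendsto (fun n : ℕ => P.real {ω | MixedKernel.Zproc g₁ g₂ W B₁ B₂ n ω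
          ≤ (2 : ℝ) ^ (-((4 : ℝ) ^ (β * (n : ℝ))))})
        atTop (𝓝 W.info)) ∧
    (∀ β : ℝ, MixedKernel.E₂ g₂ < β →
      Tendsto (fun n : ℕ => P.real {ω | (2 : ℝ) ^ (-((4 : ℝ) ^ (β * (n : ℝ))))
          ≤ MixedKernel.Zproc g₁ g₂ W B₁ B₂ n ω})
        atTop (𝓝 1)) := by
  exact ⟨fun β hβ0 hβ => MixedKernel.tendsto_measureReal_Zproc_le hB hg₂ hg₁.bijective hβ0 hβ,
    fun β hβ => MixedKernel.tendsto_measureReal_le_Zproc hB hW hβ⟩
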